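/- Let $\mathfrak{C}$ be a category with all finite limits. An internal category $\mathcal{H}$ in $\mathfrak{C}$ consists of objects $H_0$ (objects) and $H_1$ (arrows) with source and target $s,t\colon H_1\to H_0$, identities $e\colon H_0\to H_1$ and composition $m\colon H_1\times_{H_0}H_1\to H_1$ satisfying the usual category axioms; an internal functor $\Phi\colon\mathcal{H}\to\mathcal{K}$ is a pair $\Phi_0\colon H_0\to K_0$, $\Phi_1\colon H_1\to K_1$ commuting with this structure. An internal functor $p\colon\mathcal{X}\to\mathcal{K}$ is a \emph{discrete opfibration} if the square with sides $s\colon X_1\to X_0$, $p_1\colon X_1\to K_1$, $p_0\colon X_0\to K_0$, $s\colon K_1\to K_0$ is a pullback. Let $\mathbf{doFib}(\mathcal{K})$ be the category whose objects are the discrete opfibrations over $\mathcal{K}$ and whose morphisms are the internal functors between their domains that commute with the functors to $\mathcal{K}$. Discrete opfibrations are stable under pullback of internal categories (computed on objects and on arrows), so every internal functor $\Phi\colon\mathcal{H}\to\mathcal{K}$ induces a pullback functor $\Phi^*\colon\mathbf{doFib}(\mathcal{K})\to\mathbf{doFib}(\mathcal{H})$. An internal functor $\Phi\colon\mathcal{H}\to\mathcal{K}$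 is \emph{fully faithful} if the square with sides $\Phi_1\colon H_1\to K_1$, $(s,t)\colon H_1\to H_0\times H_0$, $(s,t)\colon K_1\to K_0\times K_0$, $\Phi_0\times\Phi_0$ is a pullback. A morphism $f\colon X\to Y$ of $\mathfrak{C}$ is an \emph{effective descent morphism} if, regarding the kernel pair $X\times_Y X\rightrightarrows X$ as an internal category with object of objects $X$, regarding $Y$ as a categorically discrete internal category, and regarding $f$ as an internal functor from the former to the latter, the pullback functor $f^*$ from discrete opfibrations over $Y$ to discrete opfibrations over the kernel pair is an equivalence of categories. \textbf{Theorem.} Let $\Phi\colon\mathcal{H}\to\mathcal{K}$ be an internal functor between internal categories in $\mathfrak{C}$. If $\Phi$ is fully faithful and $\Phi_0\colon H_0\to K_0$ is an effective descent morphism in $\mathfrak{C}$, then the pullback functor $\Phi^*\colon\mathbf{doFib}(\mathcal{K})\to\mathbf{doFib}(\mathcal{H})$ is an equivalence of categories. -/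

import Mathlib

open CategoryTheory CategoryTheory.Limits

universe v u

/-- An internal category in a finitely complete category `C`. The multiplication `m` takes its
arguments in diagrammatic order: it is defined on the pairs `(f, g)` with `t f = s g`. -/
structure InternalCategory (C : Type u) [Category.{v} C] [HasFiniteLimits C] where
  /-- the object of objects -/
  obj : C
  /-- the object of arrows -/
  arr : C
  /-- source -/
  s : arr ⟶ obj
  /-- target -/
  t : arr ⟶ obj
  /-- identities -/
  e : obj ⟶ arr
  /-- composition -/
  m : pullback t s ⟶ arr
  e_s : e ≫ s = 𝟙 obj
  e_t : e ≫ t = 𝟙 obj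
  m_s : m ≫ s = pullback.fst t s ≫ s
  m_t : m ≫ t = pullback.snd t s ≫ t
  /-- Associativity, on the object of composable triples `((f, g), h)`. -/
  m_assoc :
    pullback.lift
        (pullback.fst (pullback.snd t s ≫ t) s ≫ m)
        (pullback.snd (pullback.snd t s ≫ t) s)
        (by rw [Category.assoc, m_t, pullback.condition]) ≫ m =
      pullback.lift
        (pullback.fst (pullback.snd t s ≫ t) s ≫ pullback.fst t s)
        (pullback.lift
            (pullback.fst (pullback.snd t s ≫ t) s ≫ pullback.snd t s)
            (pullback.snd (pullback.snd t s ≫ t) s)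
            (by rw [Category.assoc, pullback.condition]) ≫ m)
        (by rw [Category.assoc, Category.assoc, m_s, pullback.lift_fst_assoc, Category.assoc,
              pullback.condition]) ≫ m
  e_m : pullback.lift (s ≫ e) (𝟙 arr)
    (by rw [Category.assoc, e_t, Category.comp_id, Category.id_comp]) ≫ m = 𝟙 arr
  m_e : pullback.lift (𝟙 arr) (t ≫ e)
    (by rw [Category.assoc, e_s, Category.comp_id, Category.id_comp]) ≫ m = 𝟙 arr

namespace InternalCategory

variable {C : Type u} [Category.{v} C] [HasFiniteLimits C]

attribute [local simp] pullback.lift_fst pullback.lift_snd pullback.lift_fst_assoc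
  pullback.lift_snd_assoc

/-- The composite of two composable generalised arrows `f g : T ⟶ H.arr`. -/
noncomputable def comp (H : InternalCategory C) {T : C} (f g : T ⟶ H.arr)
    (h : f ≫ H.t = g ≫ H.s) : T ⟶ H.arr :=
  pullback.lift f g h ≫ H.m

section Lemmas

variable (H : InternalCategory C) {T : C}

theorem comp_s (f g : T ⟶ H.arr) (h : f ≫ H.t = g ≫ H.s) : H.comp f g h ≫ H.s = f ≫ H.s := by
  rw [comp, Category.assoc, H.m_s, pullback.lift_fst_assoc]

theorem comp_t (f g : T ⟶ H.arr) (h : f ≫ H.t = g ≫ H.s) : H.comp f g h ≫ H.t = g ≫ H.t := by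
  rw [comp, Category.assoc, H.m_t, pullback.lift_snd_assoc]

theorem precomp_comp {S : C} (x : S ⟶ T) (f g : T ⟶ H.arr) (h : f ≫ H.t = g ≫ H.s) :
    x ≫ H.comp f g h =
      H.comp (x ≫ f) (x ≫ g) (by rw [Category.assoc, Category.assoc, h]) := by
  rw [comp, comp, ← Category.assoc]
  congr 1
  apply pullback.hom_ext <;> simp

theorem comp_congr {f f' g g' : T ⟶ H.arr} (hf : f = f') (hg : g = g')
    (h : f ≫ H.t = g ≫ H.s) : H.comp f g h = H.comp f' g' (by rw [← hf, ← hg, h]) := by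
  subst hf hg
  rfl

theorem m_eq_comp : H.m = H.comp (pullback.fst _ _) (pullback.snd _ _) pullback.condition := by
  have : pullback.lift (pullback.fst H.t H.s) (pullback.snd H.t H.s) pullback.condition = 𝟙 _ := by
    apply pullback.hom_ext <;> simp
  rw [comp, this, Category.id_comp]

theorem comp_assoc (f g h : T ⟶ H.arr) (hfg : f ≫ H.t = g ≫ H.s) (hgh : g ≫ H.t = h ≫ H.s) :
    H.comp (H.comp f g hfg) h (by rw [comp_t, hgh]) =
      H.comp f (H.comp g h hgh) (by rw [comp_s, hfg]) := by
  have key := congrArg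
    (fun k => pullback.lift (f := pullback.snd H.t H.s ≫ H.t) (g := H.s)
      (pullback.lift f g hfg) h (by rw [pullback.lift_snd_assoc, hgh]) ≫ k) H.m_assoc
  simp only [← Category.assoc] at key
  unfold comp
  convert key using 2
  · apply pullback.hom_ext <;> simp
  · apply pullback.hom_ext
    · simp
    · simp only [pullback.lift_snd, Category.assoc]
      rw [← Category.assoc]
      congr 1
      apply pullback.hom_ext <;> simp

theorem e_comp (f : T ⟶ H.arr) :
    H.comp (f ≫ H.s ≫ H.e) f (by simp only [Category.assoc, H.e_t, Category.comp_id]) = f := by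
  have key := congrArg (fun k => f ≫ k) H.e_m
  simp only [← Category.assoc, Category.comp_id] at key
  refine Eq.trans ?_ key
  unfold comp
  congr 1
  apply pullback.hom_ext <;> simp

theorem comp_e (f : T ⟶ H.arr) :
    H.comp f (f ≫ H.t ≫ H.e) (by simp only [Category.assoc, H.e_s, Category.comp_id]) = f := by
  have key := congrArg (fun k => f ≫ k) H.m_e
  simp only [← Category.assoc, Category.comp_id] at key
  refine Eq.trans ?_ key
  unfold comp
  congr 1
  apply pullback.hom_ext <;> simp

end Lemmas

/-- Internal functors. -/
@[ext]
structure Hom (H K : InternalCategory C) where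
  /-- the action on objects -/
  obj : H.obj ⟶ K.obj
  /-- the action on arrows -/
  arr : H.arr ⟶ K.arr
  arr_s : arr ≫ K.s = H.s ≫ obj
  arr_t : arr ≫ K.t = H.t ≫ obj
  e_arr : H.e ≫ arr = obj ≫ K.e
  m_arr : H.m ≫ arr =
    pullback.lift (pullback.fst H.t H.s ≫ arr) (pullback.snd H.t H.s ≫ arr)
      (by rw [Category.assoc, Category.assoc, arr_t, arr_s, pullback.condition_assoc]) ≫ K.m

theorem Hom.comp_arr {H K : InternalCategory C} (F : Hom H K) {T : C} (f g : T ⟶ H.arr)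
    (h : f ≫ H.t = g ≫ H.s) :
    H.comp f g h ≫ F.arr = K.comp (f ≫ F.arr) (g ≫ F.arr)
      (by simp only [Category.assoc, F.arr_t, F.arr_s]; rw [← Category.assoc, h,
            Category.assoc]) := by
  unfold comp
  rw [Category.assoc, F.m_arr, ← Category.assoc]
  congr 1
  apply pullback.hom_ext <;> simp

/-- The category of internal categories and internal functors in `C`. -/
instance : Category (InternalCategory C) where
  Hom := Hom
  id H :=
    { obj := 𝟙 _
      arr := 𝟙 _
      arr_s := by simp
      arr_t := by simp
      e_arr := by simp
      m_arr := by
        simp }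
  comp {H K L} F G :=
    { obj := F.obj ≫ G.obj
      arr := F.arr ≫ G.arr
      arr_s := by rw [Category.assoc, G.arr_s, ← Category.assoc, F.arr_s, Category.assoc]
      arr_t := by rw [Category.assoc, G.arr_t, ← Category.assoc, F.arr_t, Category.assoc]
      e_arr := by rw [← Category.assoc, F.e_arr, Category.assoc, G.e_arr, Category.assoc]
      m_arr := by
        rw [H.m_eq_comp, ← Category.assoc, F.comp_arr, G.comp_arr]
        unfold comp
        simp only [Category.assoc] }
  id_comp F := by apply Hom.ext <;> exact Category.id_comp _
  comp_id F := by apply Hom.ext <;> exact Category.comp_id _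
  assoc F G H := by apply Hom.ext <;> exact Category.assoc _ _ _

@[ext]
theorem hom_ext {H K : InternalCategory C} {F G : H ⟶ K} (h₀ : F.obj = G.obj)
    (h₁ : F.arr = G.arr) : F = G :=
  Hom.ext h₀ h₁

@[simp] theorem id_obj (H : InternalCategory C) : (𝟙 H : H ⟶ H).obj = 𝟙 H.obj := rfl

@[simp] theorem id_arr (H : InternalCategory C) : (𝟙 H : H ⟶ H).arr = 𝟙 H.arr := rfl

@[simp] theorem comp_obj' {H K L : InternalCategory C} (F : H ⟶ K) (G : K ⟶ L) :
    (F ≫ G).obj = F.obj ≫ G.obj := rfl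

@[simp] theorem comp_arr' {H K L : InternalCategory C} (F : H ⟶ K) (G : K ⟶ L) :
    (F ≫ G).arr = F.arr ≫ G.arr := rfl

/-! ### Classes of internal functors -/

/-- An internal functor is a discrete opfibration if the square formed with the source maps is a
pullback. -/
def IsDiscreteOpfibration {H K : InternalCategory C} (F : H ⟶ K) : Prop :=
  IsPullback H.s F.arr F.obj K.s

/-- An internal functor is fully faithful if the square formed with the maps `(s, t)` is a
pullback. -/
def IsFullyFaithful {H K : InternalCategory C} (F : H ⟶ K) : Prop :=
  IsPullback F.arr (prod.lift H.s H.t) (prod.lift K.s K.t) (prod.map F.obj F.obj)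

/-- Discrete opfibrations as a class of objects of the slice category `Cat(C)/K`. -/
def isDiscreteOpfibration (K : InternalCategory C) : ObjectProperty (Over K) :=
  fun p => IsDiscreteOpfibration p.hom

/-- The category of discrete opfibrations over `K`: its morphisms are the internal functors over
`K`. -/
abbrev DOFib (K : InternalCategory C) : Type (max u v) := (isDiscreteOpfibration K).FullSubcategory

/-! ### Pullback of internal functors -/

section Pullback

variable {X H K : InternalCategory C} (p : X ⟶ K) (Φ : H ⟶ K)

/-- The pullback `X ×_K H`, computed on objects and on arrows. -/
noncomputable def pb : InternalCategory C where
  obj := pullback p.obj Φ.obj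
  arr := pullback p.arr Φ.arr
  s := pullback.map _ _ _ _ X.s H.s K.s p.arr_s Φ.arr_s
  t := pullback.map _ _ _ _ X.t H.t K.t p.arr_t Φ.arr_t
  e := pullback.map _ _ _ _ X.e H.e K.e p.e_arr.symm Φ.e_arr.symm
  m := pullback.lift
    (X.comp (pullback.fst _ _ ≫ pullback.fst _ _) (pullback.snd _ _ ≫ pullback.fst _ _)
      (by simpa using congrArg (· ≫ pullback.fst _ _) (pullback.condition
        (f := pullback.map _ _ _ _ X.t H.t K.t p.arr_t Φ.arr_t)
        (g := pullback.map _ _ _ _ X.s H.s K.s p.arr_s Φ.arr_s))))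
    (H.comp (pullback.fst _ _ ≫ pullback.snd _ _) (pullback.snd _ _ ≫ pullback.snd _ _)
      (by simpa using congrArg (· ≫ pullback.snd _ _) (pullback.condition
        (f := pullback.map _ _ _ _ X.t H.t K.t p.arr_t Φ.arr_t)
        (g := pullback.map _ _ _ _ X.s H.s K.s p.arr_s Φ.arr_s))))
    (by
      rw [p.comp_arr, Φ.comp_arr]
      apply comp_congr <;> simp only [Category.assoc, pullback.condition])
  e_s := by
    apply pullback.hom_ext <;> simp [X.e_s, H.e_s]
  e_t := by
    apply pullback.hom_ext <;> simp [X.e_t, H.e_t]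
  m_s := by
    apply pullback.hom_ext <;> simp [comp_s]
  m_t := by
    apply pullback.hom_ext <;> simp [comp_t]
  m_assoc := by
    apply pullback.hom_ext
    · simp only [Category.assoc, pullback.lift_fst, precomp_comp]
      simp only [pullback.lift_fst_assoc, pullback.lift_snd_assoc, Category.assoc,
        pullback.lift_fst, precomp_comp]
      exact X.comp_assoc _ _ _ _ _
    · simp only [Category.assoc, pullback.lift_snd, precomp_comp]
      simp only [pullback.lift_fst_assoc, pullback.lift_snd_assoc, Category.assoc,
        pullback.lift_snd, precomp_comp]
      exact H.comp_assoc _ _ _ _ _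
  e_m := by
    apply pullback.hom_ext
    · simp only [Category.assoc, pullback.lift_fst, precomp_comp, Category.id_comp]
      refine Eq.trans (X.comp_congr ?_ ?_ _) (X.e_comp (pullback.fst _ _)) <;> simp
    · simp only [Category.assoc, pullback.lift_snd, precomp_comp, Category.id_comp]
      refine Eq.trans (H.comp_congr ?_ ?_ _) (H.e_comp (pullback.snd _ _)) <;> simp
  m_e := by
    apply pullback.hom_ext
    · simp only [Category.assoc, pullback.lift_fst, precomp_comp, Category.id_comp]
      refine Eq.trans (X.comp_congr ?_ ?_ _) (X.comp_e (pullback.fst _ _)) <;> simp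
    · simp only [Category.assoc, pullback.lift_snd, precomp_comp, Category.id_comp]
      refine Eq.trans (H.comp_congr ?_ ?_ _) (H.comp_e (pullback.snd _ _)) <;> simp

/-- The projection `X ×_K H ⟶ X`. -/
noncomputable def pbFst : pb p Φ ⟶ X where
  obj := pullback.fst p.obj Φ.obj
  arr := pullback.fst p.arr Φ.arr
  arr_s := by simp [pb]
  arr_t := by simp [pb]
  e_arr := by simp [pb]
  m_arr := pullback.lift_fst _ _ _

/-- The projection `X ×_K H ⟶ H`. -/
noncomputable def pbSnd : pb p Φ ⟶ H where
  obj := pullback.snd p.obj Φ.obj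
  arr := pullback.snd p.arr Φ.arr
  arr_s := by simp [pb]
  arr_t := by simp [pb]
  e_arr := by simp [pb]
  m_arr := pullback.lift_snd _ _ _

variable {p Φ} in
/-- The functor into `X ×_K H` induced by a commutative square. -/
noncomputable def pbLift {Z : InternalCategory C} (F : Z ⟶ X) (G : Z ⟶ H) (w : F ≫ p = G ≫ Φ) :
    Z ⟶ pb p Φ where
  obj := pullback.lift F.obj G.obj (congrArg Hom.obj w)
  arr := pullback.lift F.arr G.arr (congrArg Hom.arr w)
  arr_s := by apply pullback.hom_ext <;> simp [pb, F.arr_s, G.arr_s]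
  arr_t := by apply pullback.hom_ext <;> simp [pb, F.arr_t, G.arr_t]
  e_arr := by apply pullback.hom_ext <;> simp [pb, F.e_arr, G.e_arr]
  m_arr := by
    have hL : (pullback.fst Z.t Z.s ≫ pullback.lift F.arr G.arr (congrArg Hom.arr w)) ≫
        (pb p Φ).t = (pullback.snd Z.t Z.s ≫ pullback.lift F.arr G.arr (congrArg Hom.arr w)) ≫
        (pb p Φ).s := by
      have hw := pullback.condition (f := Z.t) (g := Z.s)
      apply pullback.hom_ext
      · simp [pb]
        simp [F.arr_s, F.arr_t, reassoc_of% hw]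
      · simp [pb]
        simp [G.arr_s, G.arr_t, reassoc_of% hw]
    apply pullback.hom_ext
    · have h := (pbFst p Φ).comp_arr
        (pullback.fst Z.t Z.s ≫ pullback.lift F.arr G.arr (congrArg Hom.arr w))
        (pullback.snd Z.t Z.s ≫ pullback.lift F.arr G.arr (congrArg Hom.arr w)) hL
      have h' : (Z.m ≫ pullback.lift F.arr G.arr (congrArg Hom.arr w)) ≫ pullback.fst _ _ =
          X.comp (pullback.fst Z.t Z.s ≫ F.arr) (pullback.snd Z.t Z.s ≫ F.arr) (by
            rw [Category.assoc, Category.assoc, F.arr_t, F.arr_s, pullback.condition_assoc]) := by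
        rw [Category.assoc, pullback.lift_fst, Z.m_eq_comp, F.comp_arr]
      refine h'.trans (Eq.trans (comp_congr _ ?_ ?_ _) h.symm)
      · exact (congrArg (pullback.fst Z.t Z.s ≫ ·) (pullback.lift_fst F.arr G.arr
          (congrArg Hom.arr w)).symm).trans (Category.assoc _ _ _).symm
      · exact (congrArg (pullback.snd Z.t Z.s ≫ ·) (pullback.lift_fst F.arr G.arr
          (congrArg Hom.arr w)).symm).trans (Category.assoc _ _ _).symm
    · have h := (pbSnd p Φ).comp_arr
        (pullback.fst Z.t Z.s ≫ pullback.lift F.arr G.arr (congrArg Hom.arr w))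
        (pullback.snd Z.t Z.s ≫ pullback.lift F.arr G.arr (congrArg Hom.arr w)) hL
      have h' : (Z.m ≫ pullback.lift F.arr G.arr (congrArg Hom.arr w)) ≫ pullback.snd _ _ =
          H.comp (pullback.fst Z.t Z.s ≫ G.arr) (pullback.snd Z.t Z.s ≫ G.arr) (by
            rw [Category.assoc, Category.assoc, G.arr_t, G.arr_s, pullback.condition_assoc]) := by
        rw [Category.assoc, pullback.lift_snd, Z.m_eq_comp, G.comp_arr]
      refine h'.trans (Eq.trans (comp_congr _ ?_ ?_ _) h.symm)
      · exact (congrArg (pullback.fst Z.t Z.s ≫ ·) (pullback.lift_snd F.arr G.arr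
          (congrArg Hom.arr w)).symm).trans (Category.assoc _ _ _).symm
      · exact (congrArg (pullback.snd Z.t Z.s ≫ ·) (pullback.lift_snd F.arr G.arr
          (congrArg Hom.arr w)).symm).trans (Category.assoc _ _ _).symm

variable {p Φ} in
theorem pbLift_fst {Z : InternalCategory C} (F : Z ⟶ X) (G : Z ⟶ H) (w : F ≫ p = G ≫ Φ) :
    pbLift F G w ≫ pbFst p Φ = F :=
  hom_ext (pullback.lift_fst F.obj G.obj (congrArg Hom.obj w))
    (pullback.lift_fst F.arr G.arr (congrArg Hom.arr w))

variable {p Φ} in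
theorem pbLift_snd {Z : InternalCategory C} (F : Z ⟶ X) (G : Z ⟶ H) (w : F ≫ p = G ≫ Φ) :
    pbLift F G w ≫ pbSnd p Φ = G :=
  hom_ext (pullback.lift_snd F.obj G.obj (congrArg Hom.obj w))
    (pullback.lift_snd F.arr G.arr (congrArg Hom.arr w))

variable {p Φ} in
theorem pb_hom_ext {Z : InternalCategory C} {F G : Z ⟶ pb p Φ}
    (h₁ : F ≫ pbFst p Φ = G ≫ pbFst p Φ) (h₂ : F ≫ pbSnd p Φ = G ≫ pbSnd p Φ) : F = G :=
  hom_ext (pullback.hom_ext (congrArg Hom.obj h₁) (congrArg Hom.obj h₂))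
    (pullback.hom_ext (congrArg Hom.arr h₁) (congrArg Hom.arr h₂))

/-- `X ×_K H` is the pullback in the category of internal categories. -/
theorem isPullback_pb : IsPullback (pbFst p Φ) (pbSnd p Φ) p Φ where
  w := hom_ext pullback.condition pullback.condition
  isLimit' := ⟨PullbackCone.IsLimit.mk _ (fun c => pbLift c.fst c.snd c.condition)
    (fun _ => pbLift_fst _ _ _) (fun _ => pbLift_snd _ _ _)
    (fun _ _ h₁ h₂ => pb_hom_ext (h₁.trans (pbLift_fst _ _ _).symm)
      (h₂.trans (pbLift_snd _ _ _).symm))⟩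

/-- Pullback along `Φ : H ⟶ K` as a functor `Cat(C)/K ⥤ Cat(C)/H`. -/
noncomputable def overPullback : Over K ⥤ Over H where
  obj q := Over.mk (pbSnd q.hom Φ)
  map {q r} k := Over.homMk
    ((isPullback_pb r.hom Φ).lift (pbFst q.hom Φ ≫ k.left) (pbSnd q.hom Φ)
      (by rw [Category.assoc, Over.w, (isPullback_pb q.hom Φ).w]))
    ((isPullback_pb r.hom Φ).lift_snd _ _ _)
  map_id q := by
    ext1
    apply (isPullback_pb q.hom Φ).hom_ext <;> simp
  map_comp {q r l} k k' := by
    ext1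
    apply (isPullback_pb l.hom Φ).hom_ext <;> simp

variable {p} in
/-- Discrete opfibrations are stable under pullback. -/
theorem IsDiscreteOpfibration.pbSnd (hp : IsDiscreteOpfibration p) :
    IsDiscreteOpfibration (pbSnd p Φ) := by
  have h₁ : IsPullback (pullback.fst p.arr Φ.arr) (pullback.snd p.arr Φ.arr) p.arr Φ.arr :=
    IsPullback.of_hasPullback _ _
  have h₀ : IsPullback (pullback.fst p.obj Φ.obj) (pullback.snd p.obj Φ.obj) p.obj Φ.obj :=
    IsPullback.of_hasPullback _ _
  have h := h₁.flip.paste_vert hp.flip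
  rw [Φ.arr_s] at h
  refine IsPullback.of_right (h₁₂ := pullback.fst p.obj Φ.obj) (h₂₂ := Φ.obj) (v₁₃ := p.obj)
    ?_ (InternalCategory.pbSnd p Φ).arr_s.symm h₀
  have e : (pb p Φ).s ≫ pullback.fst p.obj Φ.obj = pullback.fst p.arr Φ.arr ≫ X.s :=
    (pbFst p Φ).arr_s.symm
  exact e.symm ▸ h.flip

/-- Pullback along `Φ : H ⟶ K` as a functor from discrete opfibrations over `K` to discrete
opfibrations over `H`. -/
noncomputable def DOFib.pullback : DOFib K ⥤ DOFib H :=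
  ObjectProperty.lift _ (ObjectProperty.ι _ ⋙ overPullback Φ)
    (fun q => IsDiscreteOpfibration.pbSnd Φ q.property)

end Pullback

/-! ### Effective descent morphisms -/

/-- An object of `C` as a categorically discrete internal category. -/
noncomputable def disc (Y : C) : InternalCategory C where
  obj := Y
  arr := Y
  s := 𝟙 Y
  t := 𝟙 Y
  e := 𝟙 Y
  m := pullback.fst (𝟙 Y) (𝟙 Y)
  e_s := by simp
  e_t := by simp
  m_s := rfl
  m_t := pullback.condition
  m_assoc := by simp
  e_m := by simp
  m_e := by simp

/-- The kernel pair of `f : X ⟶ Y` as an internal category with object of objects `X`. -/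
noncomputable def kernel {X Y : C} (f : X ⟶ Y) : InternalCategory C where
  obj := X
  arr := pullback f f
  s := pullback.fst f f
  t := pullback.snd f f
  e := pullback.lift (𝟙 X) (𝟙 X) rfl
  m := pullback.lift (pullback.fst _ _ ≫ pullback.fst f f) (pullback.snd _ _ ≫ pullback.snd f f)
    (by
      rw [Category.assoc, Category.assoc, ← pullback.condition (f := f) (g := f),
        ← pullback.condition_assoc, ← pullback.condition (f := f) (g := f)])
  e_s := by simp
  e_t := by simp
  m_s := by simp
  m_t := by simp
  m_assoc := by apply pullback.hom_ext <;> simp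
  e_m := by apply pullback.hom_ext <;> simp
  m_e := by apply pullback.hom_ext <;> simp

/-- `f : X ⟶ Y` as an internal functor from its kernel pair to the discrete category on `Y`. -/
noncomputable def kernelToDisc {X Y : C} (f : X ⟶ Y) : kernel f ⟶ disc Y where
  obj := f
  arr := pullback.fst f f ≫ f
  arr_s := by simp [kernel, disc]
  arr_t := by simp [kernel, disc, pullback.condition]
  e_arr := by simp [kernel, disc]
  m_arr := by
    refine Eq.trans (pullback.lift_fst_assoc _ _ _ _) (Eq.trans ?_ (pullback.lift_fst _ _ _).symm)
    exact Category.assoc _ _ _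

/-- `f : X ⟶ Y` is an effective descent morphism if pulling back along `f` is an equivalence from
discrete opfibrations over `Y` (as a discrete category) to discrete opfibrations over the kernel
pair of `f`. -/
def IsEffectiveDescent {X Y : C} (f : X ⟶ Y) : Prop :=
  (DOFib.pullback (kernelToDisc f)).IsEquivalence

end InternalCategory

/-! A discrete opfibration over `L` amounts to an object over `L.obj` with an action of `L`, and
functors over `L` amount to equivariant maps (`exists_hom_of_act`, `Action.total`). Everything is
therefore a question about objects with actions, treated with generalised elements. Two inputs are
used throughout. First, every pullback of an effective descent morphism is an effective epimorphism
(`epi_fst`, `effectiveEpi_fst`), so generalised objects of `K` lift to `H` after precomposition with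
an epimorphism, and equations may be checked there. Second, by full faithfulness an arrow `k` of `K`
with chosen lifts `h`, `h'` of its ends comes from a unique arrow `h ⟶ h'` of `H`.

Faithfulness: the projection from the pullback of `P` to `P` is epi on objects, and it determines a
morphism out of `P`. Fullness: a morphism `G` between pullbacks respects in particular the arrows of
`H` over identities of `K`. These change only the `H`-component, so `G` followed by the projection
descends along the effective epimorphism to a map out of `P.obj`, and equivariance under `K` is
checked on lifts.

Essential surjectivity: for `ξ : X ⟶ H`, the arrows of `H` over identities form an image of the
kernel pair of `Φ.obj`, so restricting `ξ` to it gives a descent datum. Effective descent yields `π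
: Y ⟶ K.obj` whose pullback along `Φ.obj` is `X.obj` (`exists_descent`). To let `k` act on `y`, lift
the ends of `k` to `h`, `h'`, move `(y, h)` by the arrow `h ⟶ h'` over `k`, and forget `h'`. The
result does not depend on the lifts (`transport_inv_eq`), hence descends to an action of `K` on `Y`
(`exists_act`, `exists_action`), whose category of elements pulls back to `X`. -/

theorem CategoryTheory.EffectiveEpi.of_exists_desc {C : Type u} [Category.{v} C] {X Y : C} (f : X ⟶ Y) [Epi f]
    (h : ∀ {W : C} (g : X ⟶ W), (∀ {T : C} (z z' : T ⟶ X), z ≫ f = z' ≫ f → z ≫ g = z' ≫ g) →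
      ∃ d : Y ⟶ W, f ≫ d = g) : EffectiveEpi f where
  effectiveEpi := ⟨
    { desc := fun g hg => (h g fun z z' => hg z z').choose
      fac := fun g hg => (h g fun z z' => hg z z').choose_spec
      uniq := fun g hg d hd => by
        rw [← cancel_epi f, hd, (h g fun z z' => hg z z').choose_spec] }⟩

namespace InternalCategory

variable {C : Type u} [Category.{v} C] [HasFiniteLimits C]

attribute [local simp] pullback.lift_fst pullback.lift_snd pullback.lift_fst_assoc
  pullback.lift_snd_assoc prod.lift_fst prod.lift_snd

/-! ### The action of the base on a discrete opfibration -/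

namespace IsDiscreteOpfibration

section Act

variable {P L : InternalCategory C} {p : P ⟶ L} (hp : IsDiscreteOpfibration p) {T : C}

/-- The arrow of `P` with source `x` over the arrow `f` of `L`. -/
noncomputable def liftArr (x : T ⟶ P.obj) (f : T ⟶ L.arr) (h : x ≫ p.obj = f ≫ L.s) :
    T ⟶ P.arr :=
  IsPullback.lift hp x f h

/-- The target of the arrow of `P` with source `x` over the arrow `f` of `L`. -/
noncomputable def act (x : T ⟶ P.obj) (f : T ⟶ L.arr) (h : x ≫ p.obj = f ≫ L.s) : T ⟶ P.obj :=
  hp.liftArr x f h ≫ P.t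

@[simp]
theorem liftArr_s (x : T ⟶ P.obj) (f : T ⟶ L.arr) (h : x ≫ p.obj = f ≫ L.s) :
    hp.liftArr x f h ≫ P.s = x :=
  IsPullback.lift_fst hp x f h

@[simp]
theorem liftArr_arr (x : T ⟶ P.obj) (f : T ⟶ L.arr) (h : x ≫ p.obj = f ≫ L.s) :
    hp.liftArr x f h ≫ p.arr = f :=
  IsPullback.lift_snd hp x f h

theorem liftArr_s_assoc (x : T ⟶ P.obj) (f : T ⟶ L.arr) (h : x ≫ p.obj = f ≫ L.s) {Z : C}
    (z : P.obj ⟶ Z) : hp.liftArr x f h ≫ P.s ≫ z = x ≫ z := by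
  rw [← Category.assoc, liftArr_s]

theorem liftArr_arr_assoc (x : T ⟶ P.obj) (f : T ⟶ L.arr) (h : x ≫ p.obj = f ≫ L.s) {Z : C}
    (z : L.arr ⟶ Z) : hp.liftArr x f h ≫ p.arr ≫ z = f ≫ z := by
  rw [← Category.assoc, liftArr_arr]

include hp in
theorem arr_ext {a b : T ⟶ P.arr} (h₁ : a ≫ P.s = b ≫ P.s) (h₂ : a ≫ p.arr = b ≫ p.arr) :
    a = b :=
  IsPullback.hom_ext hp h₁ h₂

theorem act_obj (x : T ⟶ P.obj) (f : T ⟶ L.arr) (h : x ≫ p.obj = f ≫ L.s) :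
    hp.act x f h ≫ p.obj = f ≫ L.t := by
  rw [act, Category.assoc, ← p.arr_t, liftArr_arr_assoc]

theorem eq_liftArr (a : T ⟶ P.arr) :
    a = hp.liftArr (a ≫ P.s) (a ≫ p.arr) (by rw [Category.assoc, Category.assoc, p.arr_s]) :=
  hp.arr_ext (by simp) (by simp)

theorem arr_t_eq_act (a : T ⟶ P.arr) :
    a ≫ P.t =
      hp.act (a ≫ P.s) (a ≫ p.arr) (by rw [Category.assoc, Category.assoc, p.arr_s]) := by
  rw [act, ← eq_liftArr]

theorem act_congr {x x' : T ⟶ P.obj} {f f' : T ⟶ L.arr} (hx : x = x') (hf : f = f')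
    (h : x ≫ p.obj = f ≫ L.s) : hp.act x f h = hp.act x' f' (by rw [← hx, ← hf, h]) := by
  subst hx hf
  rfl

theorem precomp_act {S : C} (z : S ⟶ T) (x : T ⟶ P.obj) (f : T ⟶ L.arr)
    (h : x ≫ p.obj = f ≫ L.s) :
    z ≫ hp.act x f h =
      hp.act (z ≫ x) (z ≫ f) (by rw [Category.assoc, Category.assoc, h]) := by
  rw [act, act, ← Category.assoc]
  congr 1
  exact hp.arr_ext (by simp) (by simp)

/-- The identity arrow of `P` at `x` is the lift of the identity of `L`, by uniqueness of lifts. -/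
theorem act_id (x : T ⟶ P.obj) :
    hp.act x (x ≫ p.obj ≫ L.e) (by simp [L.e_s]) = x := by
  have h := hp.arr_t_eq_act (x ≫ P.e)
  rw [Category.assoc, P.e_t, Category.comp_id] at h
  refine Eq.trans (hp.act_congr ?_ ?_ _) h.symm
  · simp [P.e_s]
  · rw [Category.assoc, p.e_arr]

/-- The composite in `P` of the two successive lifts has source `x` and lies over the composite of
`f` and `g`, so it is the lift of that composite. -/
theorem act_comp (x : T ⟶ P.obj) (f g : T ⟶ L.arr) (h : x ≫ p.obj = f ≫ L.s)
    (hfg : f ≫ L.t = g ≫ L.s) :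
    hp.act x (L.comp f g hfg) (by rw [comp_s, h]) =
      hp.act (hp.act x f h) g (by rw [act_obj, hfg]) := by
  have hc : hp.liftArr x f h ≫ P.t =
      hp.liftArr (hp.act x f h) g (by rw [act_obj, hfg]) ≫ P.s := by
    rw [liftArr_s, act]
  have key := hp.arr_t_eq_act (P.comp _ _ hc)
  rw [comp_t] at key
  refine Eq.trans (hp.act_congr ?_ ?_ _) key.symm
  · rw [comp_s, liftArr_s]
  · rw [p.comp_arr]
    exact L.comp_congr (by simp) (by simp) _

end Act

/-! ### Functors over the base as equivariant maps -/

section Hom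

variable {P Q L : InternalCategory C} {p : P ⟶ L} {q : Q ⟶ L} (hp : IsDiscreteOpfibration p)
  (hq : IsDiscreteOpfibration q)

theorem act_comp_obj (F : P ⟶ Q) (w : F ≫ q = p) {T : C} (x : T ⟶ P.obj) (f : T ⟶ L.arr)
    (h : x ≫ p.obj = f ≫ L.s) :
    hp.act x f h ≫ F.obj =
      hq.act (x ≫ F.obj) f (by rw [← h, ← w, comp_obj', Category.assoc]) := by
  rw [act, Category.assoc, ← F.arr_t, ← Category.assoc, hq.arr_t_eq_act]
  refine hq.act_congr ?_ ?_ _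
  · rw [Category.assoc, F.arr_s, liftArr_s_assoc]
  · rw [Category.assoc, ← comp_arr', w, liftArr_arr]

include hq in
theorem hom_ext_of_obj {R : InternalCategory C} {F G : R ⟶ Q} (w : F ≫ q = G ≫ q)
    (h : F.obj = G.obj) : F = G := by
  refine hom_ext h (hq.arr_ext ?_ (congrArg Hom.arr w))
  rw [F.arr_s, G.arr_s, h]

/-- A map between objects of objects that preserves the action is a functor. -/
noncomputable def homOfAct (F₀ : P.obj ⟶ Q.obj) (w : F₀ ≫ q.obj = p.obj)
    (hF : ∀ {T : C} (x : T ⟶ P.obj) (f : T ⟶ L.arr) (h : x ≫ p.obj = f ≫ L.s),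
      hp.act x f h ≫ F₀ = hq.act (x ≫ F₀) f (by rw [← h, ← w, Category.assoc])) : P ⟶ Q where
  obj := F₀
  arr := hq.liftArr (P.s ≫ F₀) p.arr (by rw [Category.assoc, w, p.arr_s])
  arr_s := by rw [liftArr_s]
  arr_t := by
    have h := hF P.s p.arr p.arr_s.symm
    have h' := hp.arr_t_eq_act (𝟙 P.arr)
    simp only [Category.id_comp] at h'
    rw [h', h, act]
  e_arr := by
    refine hq.arr_ext ?_ ?_
    · simp [Q.e_s, reassoc_of% P.e_s]
    · rw [Category.assoc, liftArr_arr, p.e_arr, Category.assoc, q.e_arr, reassoc_of% w]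
  m_arr := by
    have hc : (pullback.fst P.t P.s ≫
          hq.liftArr (P.s ≫ F₀) p.arr (by rw [Category.assoc, w, p.arr_s])) ≫ Q.t =
        (pullback.snd P.t P.s ≫
          hq.liftArr (P.s ≫ F₀) p.arr (by rw [Category.assoc, w, p.arr_s])) ≫ Q.s := by
      have h := hF P.s p.arr p.arr_s.symm
      have h' := hp.arr_t_eq_act (𝟙 P.arr)
      simp only [Category.id_comp] at h'
      refine (Category.assoc _ _ _).trans (Eq.trans ?_ (Category.assoc _ _ _).symm)
      change pullback.fst P.t P.s ≫ hq.act (P.s ≫ F₀) p.arr _ = _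
      rw [liftArr_s, ← h, ← pullback.condition_assoc, ← h']
    change _ = Q.comp _ _ hc
    refine hq.arr_ext ?_ ?_
    · rw [comp_s, Category.assoc, liftArr_s, Category.assoc, liftArr_s, ← Category.assoc, P.m_s,
        Category.assoc]
    · rw [q.comp_arr, Category.assoc, liftArr_arr, P.m_eq_comp, p.comp_arr]
      exact L.comp_congr (by simp) (by simp) _

/-- An arrow of a discrete opfibration is a pair of a source and an arrow of the base, with target
given by the action; equivariance is thus exactly compatibility with targets. -/
theorem exists_hom_of_act (F₀ : P.obj ⟶ Q.obj) (w : F₀ ≫ q.obj = p.obj)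
    (hF : ∀ {T : C} (x : T ⟶ P.obj) (f : T ⟶ L.arr) (h : x ≫ p.obj = f ≫ L.s),
      hp.act x f h ≫ F₀ = hq.act (x ≫ F₀) f (by rw [← h, ← w, Category.assoc])) :
    ∃ F : P ⟶ Q, F ≫ q = p ∧ F.obj = F₀ :=
  ⟨homOfAct hp hq F₀ w hF, hom_ext w (liftArr_arr _ _ _ _), rfl⟩

end Hom

/-! ### The action on a pulled back discrete opfibration -/

section Pullback

variable {P K H : InternalCategory C} {p : P ⟶ K} (hp : IsDiscreteOpfibration p) (Φ : H ⟶ K)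

theorem act_pbSnd_fst {T : C} (z : T ⟶ (pb p Φ).obj) (f : T ⟶ H.arr)
    (h : z ≫ (InternalCategory.pbSnd p Φ).obj = f ≫ H.s) :
    (hp.pbSnd Φ).act z f h ≫ (pbFst p Φ).obj =
      hp.act (z ≫ (pbFst p Φ).obj) (f ≫ Φ.arr) (by
        rw [Category.assoc, Category.assoc, Φ.arr_s, ← reassoc_of% h, ← comp_obj', ← comp_obj',
          (isPullback_pb p Φ).w]) := by
  rw [act, Category.assoc, ← (pbFst p Φ).arr_t, ← Category.assoc, hp.arr_t_eq_act]
  refine hp.act_congr ?_ ?_ _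
  · rw [Category.assoc, (pbFst p Φ).arr_s, liftArr_s_assoc]
  · rw [Category.assoc, ← comp_arr', (isPullback_pb p Φ).w, comp_arr', liftArr_arr_assoc]

end Pullback

end IsDiscreteOpfibration

/-- Data of a (left) action of an internal category `L` on an object over `L.obj`. -/
structure Action (L : InternalCategory C) where
  /-- the total object -/
  obj : C
  /-- the projection -/
  proj : obj ⟶ L.obj
  /-- the action -/
  act : pullback proj L.s ⟶ obj
  act_proj : act ≫ proj = pullback.snd _ _ ≫ L.t
  act_id : pullback.lift (𝟙 obj) (proj ≫ L.e) (by simp [L.e_s]) ≫ act = 𝟙 obj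
  act_comp : ∀ {T : C} (x : T ⟶ obj) (f g : T ⟶ L.arr) (h : x ≫ proj = f ≫ L.s)
    (hfg : f ≫ L.t = g ≫ L.s),
    pullback.lift x (L.comp f g hfg) (by rw [comp_s, h]) ≫ act =
      pullback.lift (pullback.lift x f h ≫ act) g
        (by rw [Category.assoc, act_proj, pullback.lift_snd_assoc, hfg]) ≫ act

namespace Action

variable {L : InternalCategory C} (A : Action L)

/-- The category of elements of an action. -/
noncomputable def total : InternalCategory C where
  obj := A.obj
  arr := pullback A.proj L.s
  s := pullback.fst _ _
  t := A.act
  e := pullback.lift (𝟙 A.obj) (A.proj ≫ L.e) (by simp [L.e_s])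
  m := pullback.lift (pullback.fst _ _ ≫ pullback.fst _ _)
    (L.comp (pullback.fst _ _ ≫ pullback.snd _ _) (pullback.snd _ _ ≫ pullback.snd _ _) (by
      rw [Category.assoc, ← A.act_proj, pullback.condition_assoc, pullback.condition,
        Category.assoc]))
    (by simp only [comp_s, Category.assoc, pullback.condition])
  e_s := by simp
  e_t := A.act_id
  m_s := by simp
  m_t := by
    rw [A.act_comp _ _ _ (by simp only [Category.assoc, pullback.condition])]
    congr 1
    apply pullback.hom_ext
    · rw [pullback.lift_fst]
      refine Eq.trans ?_ pullback.condition
      congr 1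
      apply pullback.hom_ext <;> simp
    · simp
  m_assoc := by
    apply pullback.hom_ext
    · simp
    · simp only [Category.assoc, pullback.lift_snd, precomp_comp]
      simp only [pullback.lift_fst_assoc, pullback.lift_snd_assoc, Category.assoc,
        pullback.lift_snd, precomp_comp]
      exact L.comp_assoc _ _ _ _ _
  e_m := by
    apply pullback.hom_ext
    · simp
    · simp only [Category.assoc, pullback.lift_snd, precomp_comp, Category.id_comp]
      refine Eq.trans (L.comp_congr ?_ ?_ _) (L.e_comp (pullback.snd _ _))
      · simp [pullback.condition_assoc]
      · simp
  m_e := by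
    apply pullback.hom_ext
    · simp
    · simp only [Category.assoc, pullback.lift_snd, precomp_comp, Category.id_comp]
      refine Eq.trans (L.comp_congr ?_ ?_ _) (L.comp_e (pullback.snd _ _))
      · simp
      · simp [reassoc_of% A.act_proj]

/-- The projection from the category of elements. -/
noncomputable def totalProj : A.total ⟶ L where
  obj := A.proj
  arr := pullback.snd _ _
  arr_s := pullback.condition.symm
  arr_t := A.act_proj.symm
  e_arr := pullback.lift_snd _ _ _
  m_arr := pullback.lift_snd _ _ _

theorem isDiscreteOpfibration_totalProj : IsDiscreteOpfibration A.totalProj :=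
  IsPullback.of_hasPullback A.proj L.s

theorem totalProj_act {T : C} (x : T ⟶ A.obj) (f : T ⟶ L.arr) (h : x ≫ A.proj = f ≫ L.s) :
    A.isDiscreteOpfibration_totalProj.act x f h = pullback.lift x f h ≫ A.act := by
  refine congrArg (· ≫ A.act) (pullback.hom_ext ?_ ?_)
  · exact (A.isDiscreteOpfibration_totalProj.liftArr_s x f h).trans (pullback.lift_fst _ _ _).symm
  · exact (A.isDiscreteOpfibration_totalProj.liftArr_arr x f h).trans
      (pullback.lift_snd _ _ _).symm

end Action

/-! ### Fully faithful functors -/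

namespace IsFullyFaithful

variable {H K : InternalCategory C} {Φ : H ⟶ K} (hΦ : IsFullyFaithful Φ) {T : C}

/-- The arrow `h ⟶ h'` of `H` over the arrow `k : Φ h ⟶ Φ h'` of `K`. -/
noncomputable def preimage (k : T ⟶ K.arr) (h h' : T ⟶ H.obj) (hs : h ≫ Φ.obj = k ≫ K.s)
    (ht : h' ≫ Φ.obj = k ≫ K.t) : T ⟶ H.arr :=
  IsPullback.lift hΦ k (prod.lift h h') (by
    apply Limits.prod.hom_ext
    · simp [hs]
    · simp [ht])

variable (k : T ⟶ K.arr) (h h' : T ⟶ H.obj) (hs : h ≫ Φ.obj = k ≫ K.s) (ht : h' ≫ Φ.obj = k ≫ K.t)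

@[simp]
theorem preimage_arr : hΦ.preimage k h h' hs ht ≫ Φ.arr = k :=
  IsPullback.lift_fst hΦ _ _ _

@[simp]
theorem preimage_s : hΦ.preimage k h h' hs ht ≫ H.s = h := by
  simpa [preimage] using congrArg (· ≫ prod.fst) (IsPullback.lift_snd hΦ k (prod.lift h h') (by
    apply Limits.prod.hom_ext
    · simp [hs]
    · simp [ht]))

@[simp]
theorem preimage_t : hΦ.preimage k h h' hs ht ≫ H.t = h' := by
  simpa [preimage] using congrArg (· ≫ prod.snd) (IsPullback.lift_snd hΦ k (prod.lift h h') (by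
    apply Limits.prod.hom_ext
    · simp [hs]
    · simp [ht]))

include hΦ in
theorem arr_ext {a b : T ⟶ H.arr} (h₁ : a ≫ Φ.arr = b ≫ Φ.arr) (h₂ : a ≫ H.s = b ≫ H.s)
    (h₃ : a ≫ H.t = b ≫ H.t) : a = b := by
  refine IsPullback.hom_ext hΦ h₁ (Limits.prod.hom_ext ?_ ?_)
  · simpa using h₂
  · simpa using h₃

end IsFullyFaithful

/-! ### Generalised elements of pullbacks -/

section PbElt

variable {P H K : InternalCategory C} {p : P ⟶ K} {Φ : H ⟶ K} {T : C}

theorem isPullback_pb_obj (p : P ⟶ K) (Φ : H ⟶ K) :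
    IsPullback (pbFst p Φ).obj (pbSnd p Φ).obj p.obj Φ.obj :=
  IsPullback.of_hasPullback _ _

/-- The generalised object of `P ×_K H` with components `x` and `h`. -/
noncomputable def pbElt (x : T ⟶ P.obj) (h : T ⟶ H.obj) (w : x ≫ p.obj = h ≫ Φ.obj) :
    T ⟶ (pb p Φ).obj :=
  (isPullback_pb_obj p Φ).lift x h w

@[simp]
theorem pbElt_fst (x : T ⟶ P.obj) (h : T ⟶ H.obj) (w : x ≫ p.obj = h ≫ Φ.obj) :
    pbElt x h w ≫ (pbFst p Φ).obj = x :=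
  (isPullback_pb_obj p Φ).lift_fst _ _ _

@[simp]
theorem pbElt_snd (x : T ⟶ P.obj) (h : T ⟶ H.obj) (w : x ≫ p.obj = h ≫ Φ.obj) :
    pbElt x h w ≫ (pbSnd p Φ).obj = h :=
  (isPullback_pb_obj p Φ).lift_snd _ _ _

theorem pbElt_congr {x x' : T ⟶ P.obj} {h h' : T ⟶ H.obj} (hx : x = x') (hh : h = h')
    (w : x ≫ p.obj = h ≫ Φ.obj) : pbElt x h w = pbElt x' h' (by rw [← hx, ← hh, w]) := by
  subst hx hh
  rfl

theorem pbElt_eq_lift (x : T ⟶ P.obj) (h : T ⟶ H.obj) (w : x ≫ p.obj = h ≫ Φ.obj) :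
    pbElt x h w = pullback.lift x h w :=
  (isPullback_pb_obj p Φ).hom_ext ((pbElt_fst _ _ _).trans (pullback.lift_fst _ _ _).symm)
    ((pbElt_snd _ _ _).trans (pullback.lift_snd _ _ _).symm)

theorem eq_pbElt (z : T ⟶ (pb p Φ).obj) :
    z = pbElt (z ≫ (pbFst p Φ).obj) (z ≫ (pbSnd p Φ).obj)
      (by rw [Category.assoc, (isPullback_pb_obj p Φ).w, Category.assoc]) :=
  (isPullback_pb_obj p Φ).hom_ext (by simp) (by simp)

theorem IsDiscreteOpfibration.act_pbElt (hp : IsDiscreteOpfibration p) (x : T ⟶ P.obj)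
    (u : T ⟶ H.arr) (hx : x ≫ p.obj = u ≫ Φ.arr ≫ K.s) :
    (hp.pbSnd Φ).act (pbElt x (u ≫ H.s) (by rw [hx, Category.assoc, Φ.arr_s])) u (by simp) =
      pbElt (hp.act x (u ≫ Φ.arr) (by rw [hx, Category.assoc])) (u ≫ H.t)
        (by rw [hp.act_obj, Category.assoc, Φ.arr_t, Category.assoc]) := by
  refine (isPullback_pb_obj p Φ).hom_ext ?_ ?_
  · rw [hp.act_pbSnd_fst]
    exact (hp.act_congr (pbElt_fst _ _ _) rfl _).trans (pbElt_fst _ _ _).symm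
  · rw [act_obj, pbElt_snd]

end PbElt

/-! ### Morphisms of discrete opfibrations -/

namespace DOFib

/-- A discrete opfibration as an object of `DOFib K`. -/
abbrev of {P K : InternalCategory C} {p : P ⟶ K} (hp : IsDiscreteOpfibration p) : DOFib K :=
  ⟨Over.mk p, hp⟩

/-- A functor over `K` as a morphism of `DOFib K`. -/
abbrev homMk {K : InternalCategory C} {P Q : DOFib K} (F : P.obj.left ⟶ Q.obj.left) (w : F ≫ Q.obj.hom = P.obj.hom) :
    P ⟶ Q :=
  ObjectProperty.homMk (Over.homMk F w)

theorem hom_ext {K : InternalCategory C} {P Q : DOFib K} {F G : P ⟶ Q}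
    (h : F.hom.left.obj = G.hom.left.obj) : F = G :=
  ObjectProperty.hom_ext _ (Over.OverMorphism.ext (Q.property.hom_ext_of_obj
    ((Over.w F.hom).trans (Over.w G.hom).symm) h))

theorem pullback_map_pbFst {H K : InternalCategory C} (Φ : H ⟶ K) {P Q : DOFib K} (F : P ⟶ Q) :
    ((DOFib.pullback Φ).map F).hom.left ≫ pbFst Q.obj.hom Φ = pbFst P.obj.hom Φ ≫ F.hom.left :=
  (isPullback_pb Q.obj.hom Φ).lift_fst _ _ _

theorem pullback_map_pbFst_obj {H K : InternalCategory C} (Φ : H ⟶ K) {P Q : DOFib K}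
    (F : P ⟶ Q) :
    ((DOFib.pullback Φ).map F).hom.left.obj ≫ (pbFst Q.obj.hom Φ).obj =
      (pbFst P.obj.hom Φ).obj ≫ F.hom.left.obj :=
  congrArg Hom.obj (pullback_map_pbFst Φ F)

theorem exists_hom_of_full {H K P Q : InternalCategory C} (Φ : H ⟶ K) [(DOFib.pullback Φ).Full]
    {p : P ⟶ K} {q : Q ⟶ K} (hp : IsDiscreteOpfibration p) (hq : IsDiscreteOpfibration q)
    (G : pb p Φ ⟶ pb q Φ) (w : G ≫ pbSnd q Φ = pbSnd p Φ) :
    ∃ F : P ⟶ Q, F ≫ q = p ∧ G ≫ pbFst q Φ = pbFst p Φ ≫ F := by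
  let G' : (DOFib.pullback Φ).obj (DOFib.of hp) ⟶ (DOFib.pullback Φ).obj (DOFib.of hq) :=
    DOFib.homMk G w
  obtain ⟨F, hF⟩ := (DOFib.pullback Φ).map_surjective G'
  refine ⟨F.hom.left, Over.w F.hom, ?_⟩
  have h := pullback_map_pbFst Φ F
  rw [hF] at h
  exact h

/-- The inverse of an invertible equivariant map is again equivariant, hence underlies a functor. -/
theorem isIso_of_isIso_obj {K : InternalCategory C} {P Q : DOFib K} (F : P ⟶ Q)
    [IsIso F.hom.left.obj] : IsIso F := by
  have w : F.hom.left ≫ Q.obj.hom = P.obj.hom := Over.w F.hom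
  have w' : inv F.hom.left.obj ≫ P.obj.hom.obj = Q.obj.hom.obj := by
    rw [IsIso.inv_comp_eq, ← w, comp_obj']
  have hG : ∀ {T : C} (x : T ⟶ Q.obj.left.obj) (f : T ⟶ K.arr) (h : x ≫ Q.obj.hom.obj = f ≫ K.s),
      Q.property.act x f h ≫ inv F.hom.left.obj =
        P.property.act (x ≫ inv F.hom.left.obj) f (by rw [← h, ← w', Category.assoc]) := by
    intro T x f h
    rw [IsIso.comp_inv_eq, P.property.act_comp_obj Q.property F.hom.left w]
    exact Q.property.act_congr (by simp) rfl _
  obtain ⟨G, hw, hG'⟩ := IsDiscreteOpfibration.exists_hom_of_act Q.property P.property _ w' hG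
  refine ⟨homMk G hw, hom_ext ?_, hom_ext ?_⟩
  · exact (congrArg (F.hom.left.obj ≫ ·) hG').trans (IsIso.hom_inv_id F.hom.left.obj)
  · exact (congrArg (· ≫ F.hom.left.obj) hG').trans (IsIso.inv_hom_id F.hom.left.obj)

end DOFib

/-! ### Effective descent morphisms are universal effective epimorphisms -/

/-- A morphism of `C` as a functor between discrete categories. -/
noncomputable def discMap {Z Y : C} (a : Z ⟶ Y) : disc Z ⟶ disc Y where
  obj := a
  arr := a
  arr_s := by simp [disc]
  arr_t := by simp [disc]
  e_arr := by simp [disc]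
  m_arr := (pullback.lift_fst _ _ _).symm

theorem isDiscreteOpfibration_discMap {Z Y : C} (a : Z ⟶ Y) :
    IsDiscreteOpfibration (discMap a) :=
  have : IsIso (disc Z).s := inferInstanceAs (IsIso (𝟙 Z))
  have : IsIso (disc Y).s := inferInstanceAs (IsIso (𝟙 Y))
  IsPullback.of_horiz_isIso ⟨(discMap a).arr_s.symm⟩

/-- Every arrow of a discrete category is an identity. -/
theorem IsDiscreteOpfibration.act_disc {P : InternalCategory C} {Y : C} {p : P ⟶ disc Y}
    (hp : IsDiscreteOpfibration p) {T : C} (x : T ⟶ P.obj) (f : T ⟶ (disc Y).arr)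
    (h : x ≫ p.obj = f ≫ (disc Y).s) : hp.act x f h = x := by
  have hf : f = x ≫ p.obj ≫ (disc Y).e := by
    rw [← Category.assoc, h, Category.assoc]
    exact (Category.comp_id f).symm.trans (congrArg (f ≫ ·) (Category.comp_id (𝟙 Y)).symm)
  exact (hp.act_congr rfl hf h).trans (hp.act_id x)

namespace IsEffectiveDescent

variable {X Y : C} {f : X ⟶ Y} (hf : IsEffectiveDescent f)

include hf in
-- Maps `Z ⟶ W` are encoded by their graphs `Z ⟶ Z ⨯ W`, which are morphisms over `Y`. If two maps
-- agree on the pullback, their graphs have the same image under the pullback functor, and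
-- faithfulness applies.
theorem epi_fst {Z : C} (a : Z ⟶ Y) : Epi (pullback.fst a f) where
  left_cancellation {W} d d' h := by
    have : (DOFib.pullback (kernelToDisc f)).IsEquivalence := hf
    let P := DOFib.of (isDiscreteOpfibration_discMap a)
    let Q := DOFib.of (isDiscreteOpfibration_discMap ((prod.fst : Z ⨯ W ⟶ Z) ≫ a))
    let F (c : Z ⟶ W) : P ⟶ Q := DOFib.homMk (discMap (prod.lift (𝟙 Z) c))
      (InternalCategory.hom_ext (prod.lift_fst_assoc _ _ _ |>.trans (Category.id_comp _))
        (prod.lift_fst_assoc _ _ _ |>.trans (Category.id_comp _)))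
    have hF : F d = F d' := by
      apply (DOFib.pullback (kernelToDisc f)).map_injective
      refine DOFib.hom_ext ((isPullback_pb_obj _ _).hom_ext ?_ ?_)
      · refine (DOFib.pullback_map_pbFst_obj _ (F d)).trans
          (Eq.trans ?_ (DOFib.pullback_map_pbFst_obj _ (F d')).symm)
        change pullback.fst a f ≫ prod.lift (𝟙 Z) d = pullback.fst a f ≫ prod.lift (𝟙 Z) d'
        rw [prod.comp_lift, prod.comp_lift, h]
      · exact congrArg Hom.obj ((Over.w ((DOFib.pullback (kernelToDisc f)).map (F d)).hom).trans
          (Over.w ((DOFib.pullback (kernelToDisc f)).map (F d')).hom).symm)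
    have := congrArg (fun G : P ⟶ Q => G.hom.left.obj ≫ (prod.snd : Z ⨯ W ⟶ W)) hF
    exact (prod.lift_snd (𝟙 Z) d).symm.trans (this.trans (prod.lift_snd (𝟙 Z) d'))

include hf in
-- Fullness applied to a graph: a map `g` constant on the fibres of the projection to `Z` gives an
-- equivariant map over the kernel pair, since the kernel pair moves only the `X`-component. The
-- functor it comes from has the required factorisation as its `W`-component.
theorem effectiveEpi_fst {Z : C} (a : Z ⟶ Y) : EffectiveEpi (pullback.fst a f) := by
  have := hf.epi_fst a
  refine EffectiveEpi.of_exists_desc _ fun {W} g hg => ?_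
  have : (DOFib.pullback (kernelToDisc f)).IsEquivalence := hf
  have hp := isDiscreteOpfibration_discMap a
  have hq := isDiscreteOpfibration_discMap ((prod.fst : Z ⨯ W ⟶ Z) ≫ a)
  have hw₀ : prod.lift (pullback.fst a f) g ≫ prod.fst ≫ a = pullback.snd a f ≫ f := by
    rw [← Category.assoc, prod.lift_fst, pullback.condition]
  let G₀ : (pb (discMap a) (kernelToDisc f)).obj ⟶
      (pb (discMap ((prod.fst : Z ⨯ W ⟶ Z) ≫ a)) (kernelToDisc f)).obj :=
    pbElt (prod.lift (pullback.fst a f) g) (pullback.snd a f) hw₀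
  have hG₀ : ∀ {T : C} (x : T ⟶ (pb (discMap a) (kernelToDisc f)).obj),
      x ≫ G₀ ≫ (pbFst _ _).obj = prod.lift (x ≫ pullback.fst a f) (x ≫ g) := fun x =>
    (congrArg (x ≫ ·) (pbElt_fst _ _ hw₀)).trans (prod.comp_lift _ _ _)
  have hG₀' : G₀ ≫ (pbSnd _ _).obj = (pbSnd _ _).obj := pbElt_snd _ _ hw₀
  obtain ⟨G, hw, hG⟩ := IsDiscreteOpfibration.exists_hom_of_act (hp.pbSnd (kernelToDisc f))
    (hq.pbSnd (kernelToDisc f)) G₀ hG₀' (by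
      intro T x k h
      refine (isPullback_pb_obj _ _).hom_ext ?_ ?_
      · have e : (hp.pbSnd (kernelToDisc f)).act x k h ≫ pullback.fst a f =
            x ≫ pullback.fst a f :=
          (hp.act_pbSnd_fst _ _ _ _).trans (hp.act_disc _ _ _)
        rw [hq.act_pbSnd_fst, hq.act_disc, Category.assoc, Category.assoc, hG₀, hG₀]
        apply Limits.prod.hom_ext
        · exact (prod.lift_fst _ _).trans (e.trans (prod.lift_fst _ _).symm)
        · exact (prod.lift_snd _ _).trans ((hg _ _ e).trans (prod.lift_snd _ _).symm)
      · refine (Category.assoc _ _ _).trans ((congrArg (_ ≫ ·) hG₀').trans ?_)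
        rw [IsDiscreteOpfibration.act_obj, IsDiscreteOpfibration.act_obj])
  obtain ⟨F, -, hF⟩ := DOFib.exists_hom_of_full (kernelToDisc f) hp hq G hw
  have hF' : G.obj ≫ (pbFst _ (kernelToDisc f)).obj =
    (pbFst _ (kernelToDisc f)).obj ≫ F.obj := congrArg Hom.obj hF
  rw [hG] at hF'
  refine ⟨F.obj ≫ (prod.snd : Z ⨯ W ⟶ W), ?_⟩
  have h := congrArg (· ≫ (prod.snd : Z ⨯ W ⟶ W))
    (hF'.symm.trans (pbElt_fst _ _ hw₀))
  exact (Category.assoc _ _ _).symm.trans (h.trans (prod.lift_snd _ _))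

include hf in
theorem exists_epi_lift {T : C} (a : T ⟶ Y) :
    ∃ (S : C) (q : S ⟶ T) (h : S ⟶ X), Epi q ∧ h ≫ f = q ≫ a :=
  ⟨_, pullback.fst a f, pullback.snd a f, hf.epi_fst a, pullback.condition.symm⟩

include hf in
-- This is the object of pairs of lifts of `a` and `b`, projected to `Z`. A composite of effective
-- epimorphisms need not be one in general; here the factorisation through the first step is seen to
-- be constant on fibres by lifting `b` along a further epimorphism.
theorem effectiveEpi_fst_fst {Z : C} (a b : Z ⟶ Y) :
    EffectiveEpi (pullback.fst (pullback.fst a f ≫ b) f ≫ pullback.fst a f) := by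
  have := hf.effectiveEpi_fst a
  have := hf.effectiveEpi_fst (pullback.fst a f ≫ b)
  refine EffectiveEpi.of_exists_desc _ fun {W} g hg => ?_
  let d' := EffectiveEpi.desc (pullback.fst (pullback.fst a f ≫ b) f) g
    (fun z z' h => hg z z' (by rw [reassoc_of% h]))
  have hd' : pullback.fst (pullback.fst a f ≫ b) f ≫ d' = g := EffectiveEpi.fac _ _ _
  have hd : ∀ {T : C} (z z' : T ⟶ pullback a f),
      z ≫ pullback.fst a f = z' ≫ pullback.fst a f → z ≫ d' = z' ≫ d' := by
    intro T z z' h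
    -- A single lift `c` of `b` completes both `z` and `z'`, as they have the same image in `Z`.
    obtain ⟨S, q, c, hq, hc⟩ := hf.exists_epi_lift (z ≫ pullback.fst a f ≫ b)
    have h₁ : (q ≫ z) ≫ pullback.fst a f ≫ b = c ≫ f := by rw [hc, Category.assoc]
    have h₂ : (q ≫ z') ≫ pullback.fst a f ≫ b = c ≫ f := by
      rw [hc, Category.assoc, reassoc_of% h]
    have key := hg (pullback.lift (q ≫ z) c h₁) (pullback.lift (q ≫ z') c h₂)
      (by rw [pullback.lift_fst_assoc, pullback.lift_fst_assoc, Category.assoc, h,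
            Category.assoc])
    rw [← hd', pullback.lift_fst_assoc, pullback.lift_fst_assoc, Category.assoc,
      Category.assoc, cancel_epi] at key
    exact key
  exact ⟨EffectiveEpi.desc (pullback.fst a f) d' (fun z z' h => hd z z' h), by
    rw [Category.assoc, EffectiveEpi.fac, hd']⟩

end IsEffectiveDescent

/-- A functor over `L` between pullbacks of discrete opfibrations preserves the actions. -/
theorem IsDiscreteOpfibration.pbElt_act_comp {L K H P Q : InternalCategory C} {p : P ⟶ K}
    {q : Q ⟶ H} {Φ : L ⟶ K} {Ψ : L ⟶ H} (hp : IsDiscreteOpfibration p)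
    (hq : IsDiscreteOpfibration q) (F : pb p Φ ⟶ pb q Ψ) (w : F ≫ InternalCategory.pbSnd q Ψ =
      InternalCategory.pbSnd p Φ) {T : C} (x : T ⟶ P.obj) (u : T ⟶ L.arr)
    (hx : x ≫ p.obj = u ≫ Φ.arr ≫ K.s)
    (hz : (pbElt x (u ≫ L.s) (by rw [hx, Category.assoc, Φ.arr_s]) ≫ F.obj ≫ (pbFst q Ψ).obj) ≫
      q.obj = (u ≫ Ψ.arr) ≫ H.s) :
    pbElt (hp.act x (u ≫ Φ.arr) (by rw [hx, Category.assoc])) (u ≫ L.t)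
        (by rw [hp.act_obj, Category.assoc, Φ.arr_t, Category.assoc]) ≫ F.obj ≫ (pbFst q Ψ).obj =
      hq.act (pbElt x (u ≫ L.s) (by rw [hx, Category.assoc, Φ.arr_s]) ≫
        F.obj ≫ (pbFst q Ψ).obj) (u ≫ Ψ.arr) hz := by
  rw [← hp.act_pbElt (Φ := Φ) x u hx, ← Category.assoc,
    (hp.pbSnd Φ).act_comp_obj (hq.pbSnd Ψ) F w, hq.act_pbSnd_fst]
  exact hq.act_congr (Category.assoc _ _ _) rfl _

/-! ### Pulling back along a fully faithful functor of effective descent on objects -/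

section FullyFaithful

variable {H K : InternalCategory C} {Φ : H ⟶ K}

namespace DOFib

theorem faithful_pullback (hobj : IsEffectiveDescent Φ.obj) : (DOFib.pullback Φ).Faithful where
  map_injective {P Q F G} h := by
    have : Epi (pbFst P.obj.hom Φ).obj := hobj.epi_fst P.obj.hom.obj
    refine DOFib.hom_ext ?_
    rw [← cancel_epi (pbFst P.obj.hom Φ).obj, ← pullback_map_pbFst_obj, h,
      ← pullback_map_pbFst_obj]

end DOFib

/-- `G` is only known to respect arrows of `H`, but by full faithfulness this covers every arrow of
`K` whose ends have been lifted. -/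
theorem IsFullyFaithful.pbElt_act_comp {P Q : InternalCategory C} {p : P ⟶ K} {q : Q ⟶ K}
    (hΦ : IsFullyFaithful Φ) (hp : IsDiscreteOpfibration p) (hq : IsDiscreteOpfibration q)
    (G : pb p Φ ⟶ pb q Φ) (w : G ≫ pbSnd q Φ = pbSnd p Φ) {T : C} (x : T ⟶ P.obj)
    (k : T ⟶ K.arr) (h h' : T ⟶ H.obj) (hx : x ≫ p.obj = k ≫ K.s) (hs : h ≫ Φ.obj = k ≫ K.s)
    (ht : h' ≫ Φ.obj = k ≫ K.t) (hz : (pbElt x h (hx.trans hs.symm) ≫ G.obj ≫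
      (pbFst q Φ).obj) ≫ q.obj = k ≫ K.s) :
    pbElt (hp.act x k hx) h' (by rw [hp.act_obj, ht]) ≫ G.obj ≫ (pbFst q Φ).obj =
      hq.act (pbElt x h (hx.trans hs.symm) ≫ G.obj ≫ (pbFst q Φ).obj) k hz := by
  have hu := hΦ.preimage_arr k h h' hs ht
  have hus := hΦ.preimage_s k h h' hs ht
  have hut := hΦ.preimage_t k h h' hs ht
  -- With the preimage turned into a variable `u`, the data `k`, `h`, `h'` are replaced by the
  -- image, source and target of `u`.
  generalize hΦ.preimage k h h' hs ht = u at hu hus hut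
  subst hu hus hut
  exact hp.pbElt_act_comp hq G w x u (by rw [hx, Category.assoc]) hz

/-- `G` followed by the projection to `Q` is constant on the fibres of the projection to `P`, so it
descends on objects; equivariance of the descended map holds after an epimorphism. -/
theorem IsFullyFaithful.exists_hom_of_pb_hom {P Q : InternalCategory C} {p : P ⟶ K} {q : Q ⟶ K}
    (hΦ : IsFullyFaithful Φ) (hobj : IsEffectiveDescent Φ.obj) (hp : IsDiscreteOpfibration p)
    (hq : IsDiscreteOpfibration q) (G : pb p Φ ⟶ pb q Φ) (w : G ≫ pbSnd q Φ = pbSnd p Φ) :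
    ∃ F : P ⟶ Q, F ≫ q = p ∧ (pbFst p Φ).obj ≫ F.obj = G.obj ≫ (pbFst q Φ).obj := by
  have : EffectiveEpi (pbFst p Φ).obj := hobj.effectiveEpi_fst p.obj
  have hg : (G.obj ≫ (pbFst q Φ).obj) ≫ q.obj = (pbFst p Φ).obj ≫ p.obj := by
    rw [Category.assoc, (isPullback_pb_obj q Φ).w, ← Category.assoc, ← comp_obj', w,
      (isPullback_pb_obj p Φ).w]
  have indep : ∀ {T : C} (z z' : T ⟶ (pb p Φ).obj), z ≫ (pbFst p Φ).obj = z' ≫ (pbFst p Φ).obj →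
      z ≫ G.obj ≫ (pbFst q Φ).obj = z' ≫ G.obj ≫ (pbFst q Φ).obj := by
    intro T z z' hz
    have e : z = pbElt (z ≫ (pbFst p Φ).obj) (z ≫ (pbSnd p Φ).obj)
      (by simp only [Category.assoc, (isPullback_pb_obj p Φ).w]) := eq_pbElt z
    -- Here `k` is an identity of `K`, lifted to an arrow between the `H`-components of `z` and
    -- `z'`. Identities act trivially on `P` and on `Q`.
    have key := hΦ.pbElt_act_comp hp hq G w (z ≫ (pbFst p Φ).obj)
      ((z ≫ (pbFst p Φ).obj) ≫ p.obj ≫ K.e) (z ≫ (pbSnd p Φ).obj) (z' ≫ (pbSnd p Φ).obj)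
      (by simp [K.e_s])
      (by simp only [Category.assoc, K.e_s, Category.comp_id, (isPullback_pb_obj p Φ).w])
      (by rw [hz]; simp only [Category.assoc, K.e_t, Category.comp_id, (isPullback_pb_obj p Φ).w])
      (by
        rw [← e, Category.assoc, hg]
        simp [K.e_s])
    rw [pbElt_congr (hp.act_id _) rfl, pbElt_congr hz rfl, ← eq_pbElt] at key
    refine Eq.trans ?_ key.symm
    have hi := hq.act_id (z ≫ G.obj ≫ (pbFst q Φ).obj)
    refine hi.symm.trans (hq.act_congr ?_ ?_ _)
    · rw [← e]
    · simp only [Category.assoc, reassoc_of% hg]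
  obtain ⟨F₀, hF₀⟩ : ∃ F₀ : P.obj ⟶ Q.obj,
      (pbFst p Φ).obj ≫ F₀ = G.obj ≫ (pbFst q Φ).obj :=
    ⟨EffectiveEpi.desc _ _ (fun z z' => indep z z'), EffectiveEpi.fac _ _ _⟩
  have hw : F₀ ≫ q.obj = p.obj := by
    rw [← cancel_epi (pbFst p Φ).obj, ← Category.assoc, hF₀, hg]
  obtain ⟨F, hF, hF'⟩ := IsDiscreteOpfibration.exists_hom_of_act hp hq F₀ hw (by
    intro T x k hx
    -- Both ends of `k` lift to `H` after precomposition with `a' ≫ a`.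
    obtain ⟨S, a, h, ha, hh⟩ := hobj.exists_epi_lift (k ≫ K.s)
    obtain ⟨S', a', h', ha', hh'⟩ := hobj.exists_epi_lift (a ≫ k ≫ K.t)
    rw [← cancel_epi a, ← cancel_epi a']
    have e : pbElt ((a' ≫ a) ≫ x) (a' ≫ h) (by simp only [Category.assoc, hx, hh]) ≫
        G.obj ≫ (pbFst q Φ).obj = (a' ≫ a) ≫ x ≫ F₀ := by
      rw [← hF₀, ← Category.assoc, pbElt_fst, Category.assoc]
    have key := hΦ.pbElt_act_comp hp hq G w ((a' ≫ a) ≫ x) ((a' ≫ a) ≫ k) (a' ≫ h) h'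
      (by simp only [Category.assoc, hx]) (by simp only [Category.assoc, hh])
      (by simp only [Category.assoc, hh'])
      (by rw [e]; simp only [Category.assoc, hw, hx])
    have l : pbElt (hp.act ((a' ≫ a) ≫ x) ((a' ≫ a) ≫ k) (by simp only [Category.assoc, hx])) h'
        (by rw [hp.act_obj, hh', Category.assoc, Category.assoc]) ≫ G.obj ≫ (pbFst q Φ).obj =
        hp.act ((a' ≫ a) ≫ x) ((a' ≫ a) ≫ k) (by simp only [Category.assoc, hx]) ≫ F₀ := by
      rw [← hF₀, ← Category.assoc, pbElt_fst]
    refine (Category.assoc _ _ _).symm.trans (Eq.trans ?_ (Category.assoc _ _ _))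
    rw [hq.precomp_act, ← Category.assoc, hp.precomp_act]
    exact l.symm.trans (key.trans (hq.act_congr e rfl _)))
  exact ⟨F, hF, by rw [hF', hF₀]⟩

theorem IsFullyFaithful.full_pullback (hΦ : IsFullyFaithful Φ)
    (hobj : IsEffectiveDescent Φ.obj) : (DOFib.pullback Φ).Full where
  map_surjective {P Q} G := by
    have w : G.hom.left ≫ pbSnd Q.obj.hom Φ = pbSnd P.obj.hom Φ := Over.w G.hom
    obtain ⟨F, hF, hF'⟩ := hΦ.exists_hom_of_pb_hom hobj P.property Q.property G.hom.left w
    refine ⟨DOFib.homMk F hF, DOFib.hom_ext ((isPullback_pb_obj _ _).hom_ext ?_ ?_)⟩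
    · exact (DOFib.pullback_map_pbFst_obj Φ (DOFib.homMk F hF : P ⟶ Q)).trans hF'
    · exact congrArg Hom.obj ((Over.w ((DOFib.pullback Φ).map
        (DOFib.homMk F hF : P ⟶ Q)).hom).trans (Over.w G.hom).symm)

end FullyFaithful

theorem IsEffectiveDescent.exists_epi_lift_lift {X Y T : C} {f : X ⟶ Y}
    (hf : IsEffectiveDescent f) (a b : T ⟶ Y) :
    ∃ (S : C) (q : S ⟶ T) (h h' : S ⟶ X), Epi q ∧ h ≫ f = q ≫ a ∧ h' ≫ f = q ≫ b := by
  obtain ⟨S, q, h, hq, hh⟩ := hf.exists_epi_lift a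
  obtain ⟨S', q', h', hq', hh'⟩ := hf.exists_epi_lift (q ≫ b)
  exact ⟨S', q' ≫ q, q' ≫ h, h', epi_comp _ _, by rw [Category.assoc, hh, Category.assoc],
    by rw [hh', Category.assoc]⟩

/-! ### Essential surjectivity: descent of the underlying object -/

namespace IsFullyFaithful

variable {H K : InternalCategory C} {Φ : H ⟶ K} (hΦ : IsFullyFaithful Φ)

/-- A map `f₀ : L.obj ⟶ H.obj` such that `Φ.obj` identifies the ends of every arrow of `L` extends
to a functor, which sends every arrow of `L` to an arrow over an identity. -/
noncomputable def verticalFunctor (L : InternalCategory C) (f₀ : L.obj ⟶ H.obj)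
    (hf₀ : L.s ≫ f₀ ≫ Φ.obj = L.t ≫ f₀ ≫ Φ.obj) : L ⟶ H where
  obj := f₀
  arr := hΦ.preimage (L.s ≫ f₀ ≫ Φ.obj ≫ K.e) (L.s ≫ f₀) (L.t ≫ f₀)
    (by simp [K.e_s]) (by simp [K.e_t, hf₀])
  arr_s := hΦ.preimage_s _ _ _ _ _
  arr_t := hΦ.preimage_t _ _ _ _ _
  e_arr := by
    refine hΦ.arr_ext ?_ ?_ ?_
    · rw [Category.assoc, preimage_arr, reassoc_of% L.e_s, Category.assoc, Φ.e_arr]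
    · rw [Category.assoc, preimage_s, reassoc_of% L.e_s, Category.assoc, H.e_s, Category.comp_id]
    · rw [Category.assoc, preimage_t, reassoc_of% L.e_t, Category.assoc, H.e_t, Category.comp_id]
  m_arr := by
    change _ = H.comp _ _ _
    -- Both members of a composable pair go to arrows over the same identity of `K`, so their
    -- composite does too.
    have hc : pullback.fst L.t L.s ≫ L.s ≫ f₀ ≫ Φ.obj =
        pullback.snd L.t L.s ≫ L.s ≫ f₀ ≫ Φ.obj := by
      rw [hf₀, pullback.condition_assoc, hf₀]
    refine hΦ.arr_ext ?_ ?_ ?_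
    · rw [Category.assoc, preimage_arr, Φ.comp_arr]
      refine Eq.trans ?_ ((K.comp_congr ?_ ?_ _).trans (K.e_comp
        (pullback.snd L.t L.s ≫ L.s ≫ f₀ ≫ Φ.obj ≫ K.e))).symm
      · rw [reassoc_of% L.m_s, reassoc_of% hc]
      · rw [Category.assoc, preimage_arr]
        simp [reassoc_of% K.e_s, reassoc_of% hc]
      · rw [Category.assoc, preimage_arr]
    · simp only [comp_s, Category.assoc, preimage_s, reassoc_of% L.m_s]
    · simp only [comp_t, Category.assoc, preimage_t, reassoc_of% L.m_t]

theorem verticalFunctor_arr_arr (L : InternalCategory C) (f₀ : L.obj ⟶ H.obj)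
    (hf₀ : L.s ≫ f₀ ≫ Φ.obj = L.t ≫ f₀ ≫ Φ.obj) :
    (hΦ.verticalFunctor L f₀ hf₀).arr ≫ Φ.arr = L.s ≫ f₀ ≫ Φ.obj ≫ K.e := by
  simp [verticalFunctor]

/-- The functor from the kernel pair of `Φ.obj` to `H`, which picks the arrows over identities. -/
noncomputable def kernelFunctor : kernel Φ.obj ⟶ H :=
  hΦ.verticalFunctor (kernel Φ.obj) (𝟙 H.obj)
    ((congrArg (_ ≫ ·) (Category.id_comp Φ.obj)).trans (pullback.condition.trans
      (congrArg (_ ≫ ·) (Category.id_comp Φ.obj)).symm))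

theorem kernelFunctor_arr_arr {T : C} (c : T ⟶ (kernel Φ.obj).arr) :
    (c ≫ hΦ.kernelFunctor.arr) ≫ Φ.arr = (c ≫ (kernel Φ.obj).s) ≫ Φ.obj ≫ K.e := by
  refine (Category.assoc _ _ _).trans ((congrArg (c ≫ ·)
    (hΦ.verticalFunctor_arr_arr _ _ _)).trans (Eq.trans ?_ (Category.assoc _ _ _).symm))
  exact congrArg (fun k => c ≫ (kernel Φ.obj).s ≫ k) (Category.id_comp (Φ.obj ≫ K.e))

include hΦ in
/-- The object over `K.obj` obtained from a discrete opfibration over `H` by descent. -/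
theorem exists_descent (hobj : IsEffectiveDescent Φ.obj) {X : InternalCategory C} {ξ : X ⟶ H}
    (hξ : IsDiscreteOpfibration ξ) :
    ∃ (Y : C) (π : Y ⟶ K.obj) (i : pullback π Φ.obj ≅ X.obj),
      i.hom ≫ ξ.obj = pullback.snd π Φ.obj ∧
      ∀ {T : C} (y : T ⟶ Y) (u : T ⟶ H.arr) (hs : y ≫ π = (u ≫ H.s) ≫ Φ.obj)
        (ht : y ≫ π = (u ≫ H.t) ≫ Φ.obj) (_ : u ≫ Φ.arr = y ≫ π ≫ K.e)
        (hz : (pullback.lift y (u ≫ H.s) hs ≫ i.hom) ≫ ξ.obj = u ≫ H.s),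
        pullback.lift y (u ≫ H.t) ht ≫ i.hom =
          hξ.act (pullback.lift y (u ≫ H.s) hs ≫ i.hom) u hz := by
  have : (DOFib.pullback (kernelToDisc Φ.obj)).IsEquivalence := hobj
  -- The restriction of `ξ` to the kernel pair is a descent datum; `P` is a preimage of it under the
  -- descent equivalence.
  obtain ⟨P, p, hp, F, F', w, hFF', hF'F⟩ : ∃ (P : InternalCategory C) (p : P ⟶ disc K.obj)
      (_ : IsDiscreteOpfibration p) (F : pb p (kernelToDisc Φ.obj) ⟶ pb ξ hΦ.kernelFunctor)
      (F' : pb ξ hΦ.kernelFunctor ⟶ pb p (kernelToDisc Φ.obj)), F ≫ pbSnd _ _ = pbSnd _ _ ∧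
      F ≫ F' = 𝟙 _ ∧ F' ≫ F = 𝟙 _ := by
    let R := (DOFib.pullback hΦ.kernelFunctor).obj (DOFib.of hξ)
    let P := (DOFib.pullback (kernelToDisc Φ.obj)).objPreimage R
    let j := (DOFib.pullback (kernelToDisc Φ.obj)).objObjPreimageIso R
    exact ⟨P.obj.left, P.obj.hom, P.property, j.hom.hom.left, j.inv.hom.left, Over.w j.hom.hom,
      congrArg (fun k => k.hom.left) j.hom_inv_id,
      congrArg (fun k => k.hom.left) j.inv_hom_id⟩
  have hid : ∀ {T : C} (z : T ⟶ H.obj), z ≫ hΦ.kernelFunctor.obj = z := Category.comp_id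
  have hw := (isPullback_pb_obj ξ hΦ.kernelFunctor).w.trans (hid _)
  -- `kernelFunctor` is the identity on objects, so restriction along it leaves the object `X.obj`
  -- unchanged up to the isomorphism `G`.
  let G : X.obj ⟶ (pb ξ hΦ.kernelFunctor).obj := pbElt (𝟙 _) ξ.obj
    ((Category.id_comp _).trans (hid _).symm)
  have hG : G ≫ (pbFst _ _).obj = 𝟙 _ := pbElt_fst _ _ _
  have hG' : (pbFst ξ hΦ.kernelFunctor).obj ≫ G = 𝟙 _ := by
    refine (isPullback_pb_obj _ _).hom_ext ?_ ?_
    · rw [Category.assoc, hG, Category.comp_id, Category.id_comp]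
    · exact (Category.assoc _ _ _).trans ((congrArg (_ ≫ ·) (pbElt_snd _ _ _)).trans
        (hw.trans (Category.id_comp _).symm))
  have h₁ : (F.obj ≫ (pbFst _ _).obj) ≫ G ≫ F'.obj = 𝟙 _ := by
    rw [Category.assoc, reassoc_of% hG']
    exact congrArg Hom.obj hFF'
  have h₂ : (G ≫ F'.obj) ≫ F.obj ≫ (pbFst _ _).obj = 𝟙 _ := by
    have h : F'.obj ≫ F.obj = 𝟙 _ := congrArg Hom.obj hF'F
    rw [Category.assoc, reassoc_of% h, hG]
  refine ⟨P.obj, p.obj, ⟨F.obj ≫ (pbFst _ _).obj, G ≫ F'.obj, h₁, h₂⟩, ?_, ?_⟩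
  · refine (Category.assoc _ _ _).trans ((congrArg (F.obj ≫ ·) hw).trans ?_)
    exact congrArg Hom.obj w
  · intro T y u hs ht hu hz
    -- An arrow `u` over an identity is the image of the pair of its ends. The isomorphism `F` is
    -- equivariant for the kernel pair, and the discrete base leaves `y` fixed.
    let c : T ⟶ (kernel Φ.obj).arr := pullback.lift (u ≫ H.s) (u ≫ H.t) (hs.symm.trans ht)
    have hcs : c ≫ (kernel Φ.obj).s = u ≫ H.s := pullback.lift_fst _ _ _
    have hct : c ≫ (kernel Φ.obj).t = u ≫ H.t := pullback.lift_snd _ _ _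
    have hcu : c ≫ hΦ.kernelFunctor.arr = u := by
      refine hΦ.arr_ext ?_ ?_ ?_
      · rw [kernelFunctor_arr_arr, hcs, hu]
        exact (Category.assoc _ _ _).symm.trans ((congrArg (· ≫ K.e) hs.symm).trans
          (Category.assoc _ _ _))
      · rw [Category.assoc, hΦ.kernelFunctor.arr_s, ← Category.assoc, hcs]
        exact hid _
      · rw [Category.assoc, hΦ.kernelFunctor.arr_t, ← Category.assoc, hct]
        exact hid _
    have hx : y ≫ p.obj = c ≫ (kernelToDisc Φ.obj).arr ≫ (disc K.obj).s := by
      rw [(kernelToDisc Φ.obj).arr_s, reassoc_of% hcs]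
      exact hs
    have hz' : (pbElt y (c ≫ (kernel Φ.obj).s) (by rw [hx, Category.assoc, Hom.arr_s]) ≫ F.obj ≫
        (pbFst ξ hΦ.kernelFunctor).obj) ≫ ξ.obj = (c ≫ hΦ.kernelFunctor.arr) ≫ H.s := by
      rw [hcu, ← hz]
      congr 2
      exact (pbElt_congr rfl hcs _).trans (pbElt_eq_lift _ _ _)
    have key := hp.pbElt_act_comp hξ F w y c hx hz'
    refine Eq.trans ?_ (key.trans (hξ.act_congr ?_ hcu _))
    · exact congrArg (· ≫ _) (Eq.trans (pbElt_eq_lift (p := p) (Φ := kernelToDisc Φ.obj) y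
        (u ≫ H.t) ht).symm (pbElt_congr (p := p) (Φ := kernelToDisc Φ.obj)
          (hp.act_disc y (c ≫ (kernelToDisc Φ.obj).arr)
          (by rw [hx, Category.assoc])).symm hct.symm ht))
    · exact congrArg (· ≫ _) ((pbElt_congr rfl hcs _).trans (pbElt_eq_lift _ _ _))

/-! ### Transport along arrows of `K` and the action on the descended object -/

section Transport

variable {X : InternalCategory C} {ξ : X ⟶ H} (hξ : IsDiscreteOpfibration ξ) {Y : C}
  {π : Y ⟶ K.obj} (i : pullback π Φ.obj ≅ X.obj) (hi : i.hom ≫ ξ.obj = pullback.snd π Φ.obj)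
  {T : C}

theorem inv_comp_snd {X₀ H₀ K₀ Y : C} {π : Y ⟶ K₀} {f : H₀ ⟶ K₀} {ξ₀ : X₀ ⟶ H₀}
    (i : pullback π f ≅ X₀) (hi : i.hom ≫ ξ₀ = pullback.snd π f) :
    i.inv ≫ pullback.snd π f = ξ₀ := by
  rw [Iso.inv_comp_eq, hi]

/-- The action on `(y, h)` of the arrow `h ⟶ h'` of `H` over `k`. -/
noncomputable def transport (y : T ⟶ Y) (k : T ⟶ K.arr) (h h' : T ⟶ H.obj)
    (hy : y ≫ π = k ≫ K.s) (hs : h ≫ Φ.obj = k ≫ K.s) (ht : h' ≫ Φ.obj = k ≫ K.t) : T ⟶ X.obj :=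
  hξ.act (pullback.lift y h (hy.trans hs.symm) ≫ i.hom) (hΦ.preimage k h h' hs ht)
    (by rw [Category.assoc, hi, preimage_s, pullback.lift_snd])

section

variable (y : T ⟶ Y) (k : T ⟶ K.arr) (h h' : T ⟶ H.obj)
    (hy : y ≫ π = k ≫ K.s) (hs : h ≫ Φ.obj = k ≫ K.s) (ht : h' ≫ Φ.obj = k ≫ K.t)

theorem transport_obj : hΦ.transport hξ i hi y k h h' hy hs ht ≫ ξ.obj = h' := by
  rw [transport, hξ.act_obj, preimage_t]

theorem precomp_transport {S : C} (z : S ⟶ T) : z ≫ hΦ.transport hξ i hi y k h h' hy hs ht =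
    hΦ.transport hξ i hi (z ≫ y) (z ≫ k) (z ≫ h) (z ≫ h') (by simp only [Category.assoc, hy])
      (by simp only [Category.assoc, hs]) (by simp only [Category.assoc, ht]) := by
  rw [transport, transport, hξ.precomp_act]
  refine hξ.act_congr ?_ (hΦ.arr_ext ?_ ?_ ?_) _
  · rw [← Category.assoc]
    congr 1
    apply pullback.hom_ext <;> simp
  all_goals simp

theorem transport_inv_comp :
    (hΦ.transport hξ i hi y k h h' hy hs ht ≫ i.inv ≫ pullback.fst π Φ.obj) ≫ π = k ≫ K.t := by
  rw [Category.assoc, Category.assoc, pullback.condition, reassoc_of% inv_comp_snd i hi,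
    reassoc_of% transport_obj, ht]

/-- The preimage of `u ≫ Φ.arr` between the ends of `u` is `u`. This later identifies the pulled
back action with that of `ξ`. -/
theorem transport_comp_arr {x : T ⟶ Y} {u : T ⟶ H.arr}
    (hx : x ≫ π = (u ≫ H.s) ≫ Φ.obj) :
    hΦ.transport hξ i hi x (u ≫ Φ.arr) (u ≫ H.s) (u ≫ H.t)
      (by rw [hx, Category.assoc, Category.assoc, Φ.arr_s]) (by simp [Φ.arr_s])
      (by simp [Φ.arr_t]) = hξ.act (pullback.lift x (u ≫ H.s) hx ≫ i.hom) u
      (by rw [Category.assoc, hi, pullback.lift_snd]) :=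
  hξ.act_congr rfl (hΦ.arr_ext (by simp) (by simp) (by simp)) _

/-- No information is lost in passing to the `Y`-component: the other component of a transported
object is the prescribed `h'`. -/
theorem lift_transport (z : T ⟶ Y)
    (hz : z = hΦ.transport hξ i hi y k h h' hy hs ht ≫ i.inv ≫ pullback.fst π Φ.obj)
    (hw : z ≫ π = h' ≫ Φ.obj) :
    pullback.lift z h' hw ≫ i.hom = hΦ.transport hξ i hi y k h h' hy hs ht := by
  rw [← Iso.eq_comp_inv]
  apply pullback.hom_ext
  · rw [pullback.lift_fst, hz, Category.assoc]
  · rw [pullback.lift_snd, Category.assoc, inv_comp_snd i hi, transport_obj]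

/-- By uniqueness of preimages, the preimage of `k` followed by `v` is the preimage of the composite
in `K`. -/
theorem act_transport (v : T ⟶ H.arr) (hv : h' = v ≫ H.s) :
    hξ.act (hΦ.transport hξ i hi y k h h' hy hs ht) v (by rw [transport_obj, hv]) =
      hΦ.transport hξ i hi y (K.comp k (v ≫ Φ.arr)
        (by rw [← ht, hv, Category.assoc, Category.assoc, Φ.arr_s])) h (v ≫ H.t)
        (by rw [comp_s, hy]) (by rw [comp_s, hs])
        (by rw [comp_t, Category.assoc, Category.assoc, Φ.arr_t]) := by
  refine (hξ.act_comp _ _ _ _ (by rw [preimage_t, hv])).symm.trans ?_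
  refine hξ.act_congr rfl (hΦ.arr_ext ?_ ?_ ?_) _
  · rw [Φ.comp_arr]
    exact (K.comp_congr (preimage_arr _ _ _ _ _ _) rfl _).trans (preimage_arr _ _ _ _ _ _).symm
  · rw [comp_s, preimage_s, preimage_s]
  · rw [comp_t, preimage_t]

end

variable (hact : ∀ {T : C} (y : T ⟶ Y) (u : T ⟶ H.arr) (hs : y ≫ π = (u ≫ H.s) ≫ Φ.obj)
        (ht : y ≫ π = (u ≫ H.t) ≫ Φ.obj) (_ : u ≫ Φ.arr = y ≫ π ≫ K.e)
        (hz : (pullback.lift y (u ≫ H.s) hs ≫ i.hom) ≫ ξ.obj = u ≫ H.s),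
        pullback.lift y (u ≫ H.t) ht ≫ i.hom =
          hξ.act (pullback.lift y (u ≫ H.s) hs ≫ i.hom) u hz)

include hact in
-- Independence of the lifts. Take `v : h ⟶ j` and `u : h' ⟶ j'` over identities. The square they
-- form with the two preimages of `k` commutes, since both ways round lie over `k`; and by `hact`
-- the arrows `u` and `v` do not affect the `Y`-component.
theorem transport_inv_eq {y y' : T ⟶ Y} {k k' : T ⟶ K.arr} (ey : y = y') (ek : k = k')
    (h h' j j' : T ⟶ H.obj) (hy : y ≫ π = k ≫ K.s) (hs : h ≫ Φ.obj = k ≫ K.s)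
    (ht : h' ≫ Φ.obj = k ≫ K.t) (hy' : y' ≫ π = k' ≫ K.s) (js : j ≫ Φ.obj = k' ≫ K.s)
    (jt : j' ≫ Φ.obj = k' ≫ K.t) :
    hΦ.transport hξ i hi y k h h' hy hs ht ≫ i.inv ≫ pullback.fst π Φ.obj =
      hΦ.transport hξ i hi y' k' j j' hy' js jt ≫ i.inv ≫ pullback.fst π Φ.obj := by
  subst ey ek
  obtain ⟨z, hz⟩ : ∃ z, z =
    hΦ.transport hξ i hi y k h h' hy hs ht ≫ i.inv ≫ pullback.fst π Φ.obj := ⟨_, rfl⟩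
  have hzπ : z ≫ π = k ≫ K.t := by rw [hz, transport_inv_comp]
  obtain ⟨u, hu, hus, hut⟩ : ∃ u : T ⟶ H.arr, u ≫ Φ.arr = z ≫ π ≫ K.e ∧ u ≫ H.s = h' ∧
      u ≫ H.t = j' :=
    ⟨hΦ.preimage (z ≫ π ≫ K.e) h' j' (by simp [K.e_s, hzπ, ht]) (by simp [K.e_t, hzπ, jt]),
      by simp, by simp, by simp⟩
  obtain ⟨v, hv, hvs, hvt⟩ : ∃ u : T ⟶ H.arr, u ≫ Φ.arr = y ≫ π ≫ K.e ∧ u ≫ H.s = h ∧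
      u ≫ H.t = j :=
    ⟨hΦ.preimage (y ≫ π ≫ K.e) h j (by simp [K.e_s, hy, hs]) (by simp [K.e_t, hy, js]),
      by simp, by simp, by simp⟩
  subst hus hut hvs hvt
  have h₁ := hact z u (hzπ.trans ht.symm) (hzπ.trans jt.symm) hu
    (by rw [Category.assoc, hi, pullback.lift_snd])
  have h₂ := hact y v (hy.trans hs.symm) (hy.trans js.symm) hv
    (by rw [Category.assoc, hi, pullback.lift_snd])
  have key : pullback.lift z (u ≫ H.t) (hzπ.trans jt.symm) ≫ i.hom =
      hΦ.transport hξ i hi y k (v ≫ H.t) (u ≫ H.t) hy' js jt := by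
    rw [h₁]
    refine (hξ.act_congr (hΦ.lift_transport hξ i hi y k _ _ hy hs ht z hz _) rfl _).trans ?_
    rw [act_transport _ _ _ _ _ _ _ _ _ _ _ _ rfl, transport, transport]
    refine Eq.trans ?_ (hξ.act_congr h₂.symm rfl (by
      rw [← h₂, Category.assoc, hi, pullback.lift_snd, preimage_s]))
    rw [← hξ.act_comp _ _ _ _ (by rw [preimage_s])]
    refine hξ.act_congr rfl (hΦ.arr_ext ?_ ?_ ?_) _
    · rw [preimage_arr, Φ.comp_arr]
      refine (K.comp_congr rfl ?_ _).trans ((K.comp_e k).trans ((K.e_comp k).symm.trans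
        (K.comp_congr ?_ ?_ _)))
      · rw [hu, reassoc_of% hzπ]
      · rw [hv, reassoc_of% hy]
      · rw [preimage_arr]
    · rw [preimage_s, comp_s]
    · rw [preimage_t, comp_t, preimage_t]
  rw [← hz, ← key]
  simp

include hact in
-- Transport is defined on the object of pairs `(y, k)` with lifts of both ends of `k`. It is
-- independent of the lifts, and forgetting them is an effective epimorphism.
theorem exists_act (hobj : IsEffectiveDescent Φ.obj) : ∃ a : pullback π K.s ⟶ Y,
    ∀ {T : C} (y : T ⟶ Y) (k : T ⟶ K.arr) (h h' : T ⟶ H.obj) (hy : y ≫ π = k ≫ K.s)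
      (hs : h ≫ Φ.obj = k ≫ K.s) (ht : h' ≫ Φ.obj = k ≫ K.t), pullback.lift y k hy ≫ a =
        hΦ.transport hξ i hi y k h h' hy hs ht ≫ i.inv ≫ pullback.fst π Φ.obj := by
  have := hobj.effectiveEpi_fst_fst (pullback.snd π K.s ≫ K.s) (pullback.snd π K.s ≫ K.t)
  -- Only the universal property of the iterated pullback is kept: `S` carries the universal pair of
  -- lifts `h`, `h'`.
  obtain ⟨S, q, h, h', hq, hh, hh', hu⟩ : ∃ (S : C) (q : S ⟶ pullback π K.s) (h h' : S ⟶ H.obj),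
      EffectiveEpi q ∧ h ≫ Φ.obj = q ≫ pullback.snd π K.s ≫ K.s ∧
      h' ≫ Φ.obj = q ≫ pullback.snd π K.s ≫ K.t ∧
      ∀ {T : C} (z : T ⟶ pullback π K.s) (j j' : T ⟶ H.obj),
        j ≫ Φ.obj = z ≫ pullback.snd π K.s ≫ K.s → j' ≫ Φ.obj = z ≫ pullback.snd π K.s ≫ K.t →
        ∃ c : T ⟶ S, c ≫ q = z ∧ c ≫ h = j ∧ c ≫ h' = j' :=
    ⟨_, _, pullback.fst _ _ ≫ pullback.snd _ _, pullback.snd _ _, this,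
      (Category.assoc _ _ _).trans ((congrArg (_ ≫ ·) pullback.condition.symm).trans
        (Category.assoc _ _ _).symm),
      pullback.condition.symm.trans (Category.assoc _ _ _).symm,
      fun z j j' hj hj' => ⟨pullback.lift (pullback.lift z j hj.symm) j'
        (by rw [pullback.lift_fst_assoc, hj']), by simp, by simp, by simp⟩⟩
  let g := hΦ.transport hξ i hi (q ≫ pullback.fst π K.s) (q ≫ pullback.snd π K.s) h h'
    (by simp [pullback.condition]) (by simp [hh]) (by simp [hh']) ≫ i.inv ≫ pullback.fst π Φ.obj
  have hg : ∀ {T : C} (z z' : T ⟶ S), z ≫ q = z' ≫ q → z ≫ g = z' ≫ g := by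
    intro T z z' hz
    dsimp only [g]
    rw [← Category.assoc, ← Category.assoc z', precomp_transport, precomp_transport]
    exact hΦ.transport_inv_eq hξ i hi hact (by rw [reassoc_of% hz]) (by rw [reassoc_of% hz])
      _ _ _ _ _ _ _ _ _ _
  refine ⟨EffectiveEpi.desc q g (fun z z' => hg z z'), fun {T} y k j j' hy hs ht => ?_⟩
  obtain ⟨c, hc, rfl, rfl⟩ := hu (pullback.lift y k hy) j j' (by simp [hs]) (by simp [ht])
  rw [← hc, Category.assoc, EffectiveEpi.fac]
  dsimp only [g]
  rw [← Category.assoc, precomp_transport]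
  exact hΦ.transport_inv_eq hξ i hi hact (by simp [reassoc_of% hc]) (by simp [reassoc_of% hc])
    _ _ _ _ _ _ _ _ _ _

include hact in
-- Each axiom may be tested after an epimorphism on which the objects involved lift to `H`. There
-- `a` is computed by transport, and the axiom comes from the action on `X`.
theorem exists_action (hobj : IsEffectiveDescent Φ.obj) : ∃ (a : pullback π K.s ⟶ Y)
    (h₁ : a ≫ π = pullback.snd _ _ ≫ K.t)
    (_ : pullback.lift (𝟙 Y) (π ≫ K.e) (by simp [K.e_s]) ≫ a = 𝟙 Y),
    (∀ {T : C} (x : T ⟶ Y) (f g : T ⟶ K.arr) (h : x ≫ π = f ≫ K.s) (hfg : f ≫ K.t = g ≫ K.s),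
    pullback.lift x (K.comp f g hfg) (by rw [comp_s, h]) ≫ a =
      pullback.lift (pullback.lift x f h ≫ a) g
        (by rw [Category.assoc, h₁, pullback.lift_snd_assoc, hfg]) ≫ a) ∧
    ∀ {T : C} (y : T ⟶ Y) (k : T ⟶ K.arr) (h h' : T ⟶ H.obj) (hy : y ≫ π = k ≫ K.s)
      (hs : h ≫ Φ.obj = k ≫ K.s) (ht : h' ≫ Φ.obj = k ≫ K.t), pullback.lift y k hy ≫ a =
        hΦ.transport hξ i hi y k h h' hy hs ht ≫ i.inv ≫ pullback.fst π Φ.obj := by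
  obtain ⟨a, ha⟩ := hΦ.exists_act hξ i hi hact hobj
  have lift_comp : ∀ {S T : C} (q : S ⟶ T) (y : T ⟶ Y) (k : T ⟶ K.arr) (hy : y ≫ π = k ≫ K.s),
      q ≫ pullback.lift y k hy ≫ a = pullback.lift (q ≫ y) (q ≫ k)
        (by simp only [Category.assoc, hy]) ≫ a := by
    intro S T q y k hy
    rw [← Category.assoc]
    congr 1
    apply pullback.hom_ext <;> simp
  have h₁ : a ≫ π = pullback.snd _ _ ≫ K.t := by
    obtain ⟨S, q, h, h', hq, hh, hh'⟩ := hobj.exists_epi_lift_lift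
      (pullback.snd π K.s ≫ K.s) (pullback.snd π K.s ≫ K.t)
    have e := ha (q ≫ pullback.fst π K.s) (q ≫ pullback.snd π K.s) h h'
      (by simp [pullback.condition]) (by simp [hh]) (by simp [hh'])
    have e' : q = pullback.lift (q ≫ pullback.fst π K.s) (q ≫ pullback.snd π K.s)
        (by simp [pullback.condition]) := by apply pullback.hom_ext <;> simp
    rw [← e'] at e
    rw [← cancel_epi q, ← Category.assoc, e, transport_inv_comp, Category.assoc]
  refine ⟨a, h₁, ?_, ?_, ha⟩
  -- The same lift `h` serves for both ends, so the preimage of the identity of `K` is the identity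
  -- of `h`.
  · obtain ⟨S, q, h, hq, hh⟩ := hobj.exists_epi_lift π
    rw [← cancel_epi q, lift_comp, ha _ _ h h (by simp [K.e_s]) (by simp [K.e_s, hh])
      (by simp [K.e_t, hh]), transport]
    have e := hξ.act_id (pullback.lift (q ≫ 𝟙 Y) h (by simp [hh]) ≫ i.hom)
    refine (congrArg (· ≫ i.inv ≫ pullback.fst π Φ.obj)
      ((hξ.act_congr rfl (hΦ.arr_ext ?_ ?_ ?_) _).trans e)).trans (by simp)
    · simp [reassoc_of% hi, Φ.e_arr, reassoc_of% hh]
    · simp [reassoc_of% hi, H.e_s]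
    · simp [reassoc_of% hi, H.e_t]
  · intro T x f g hx hfg
    -- All three objects of the composable pair `f`, `g` are lifted, the middle one only once, so
    -- that the two preimages are composable in `H`.
    obtain ⟨S₀, q₀, h₀, h₀', hq₀, hh₀, hh₀'⟩ := hobj.exists_epi_lift_lift (f ≫ K.s) (f ≫ K.t)
    obtain ⟨S, q₁, h'', hq₁, hh''⟩ := hobj.exists_epi_lift (q₀ ≫ g ≫ K.t)
    obtain ⟨q, hq⟩ : ∃ q, q = q₁ ≫ q₀ := ⟨_, rfl⟩
    obtain ⟨h, hh⟩ : ∃ h, h = q₁ ≫ h₀ := ⟨_, rfl⟩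
    obtain ⟨h', hh'⟩ : ∃ h', h' = q₁ ≫ h₀' := ⟨_, rfl⟩
    have hs : h ≫ Φ.obj = (q ≫ f) ≫ K.s := by simp [hh, hq, hh₀]
    have ht : h' ≫ Φ.obj = (q ≫ f) ≫ K.t := by simp [hh', hq, hh₀']
    have hs' : h' ≫ Φ.obj = (q ≫ g) ≫ K.s := by rw [ht, Category.assoc, Category.assoc, hfg]
    have ht' : h'' ≫ Φ.obj = (q ≫ g) ≫ K.t := by simp [hq, hh'']
    have : Epi q := hq ▸ epi_comp _ _
    have hx' : (q ≫ x) ≫ π = (q ≫ f) ≫ K.s := by simp [hx]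
    have e := ha (q ≫ x) (q ≫ f) h h' hx' hs ht
    have hz : (pullback.lift (q ≫ x) (q ≫ f) hx' ≫ a) ≫ π = (q ≫ g) ≫ K.s := by
      rw [Category.assoc, h₁, pullback.lift_snd_assoc, ← ht, hs']
    have e' := ha (pullback.lift (q ≫ x) (q ≫ f) hx' ≫ a) (q ≫ g) h' h'' hz hs' ht'
    rw [← cancel_epi q, lift_comp, lift_comp]
    have l : pullback.lift (q ≫ pullback.lift x f hx ≫ a) (q ≫ g)
        (by rw [lift_comp, hz]) ≫ a =
        pullback.lift (pullback.lift (q ≫ x) (q ≫ f) hx' ≫ a) (q ≫ g) hz ≫ a := by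
      congr 2
      exact lift_comp _ _ _ _
    refine Eq.trans ?_ (e'.symm.trans l.symm)
    have hc : (q ≫ f) ≫ K.t = (q ≫ g) ≫ K.s := ht.symm.trans hs'
    have l' : pullback.lift (f := π) (g := K.s) (q ≫ x) (q ≫ K.comp f g hfg) (by simp [comp_s, hx]) =
        pullback.lift (q ≫ x) (K.comp (q ≫ f) (q ≫ g) hc) (by rw [comp_s, hx']) := by
      congr 1
      exact K.precomp_comp _ _ _ _
    refine (congrArg (· ≫ a) l').trans ((ha _ _ h h'' _ (by rw [comp_s, hs])
      (by rw [comp_t, ht'])).trans (congrArg (· ≫ i.inv ≫ pullback.fst π Φ.obj) ?_))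
    have m := hΦ.act_transport hξ i hi _ _ h h' hx' hs ht (hΦ.preimage (q ≫ g) h' h'' hs' ht')
      (by simp)
    have m' : hξ.act (hΦ.transport hξ i hi _ _ h h' hx' hs ht)
        (hΦ.preimage (q ≫ g) h' h'' hs' ht') (by rw [transport_obj, preimage_s]) =
        hΦ.transport hξ i hi (pullback.lift (q ≫ x) (q ≫ f) hx' ≫ a) (q ≫ g) h' h'' hz hs' ht' :=
      hξ.act_congr (hΦ.lift_transport hξ i hi _ _ _ _ hx' hs ht _ e _).symm rfl _
    refine Eq.trans ?_ (m.symm.trans m')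
    congr 1
    · exact K.comp_congr rfl (by simp) _
    · simp

end Transport

include hΦ in
theorem essSurj_pullback (hobj : IsEffectiveDescent Φ.obj) : (DOFib.pullback Φ).EssSurj where
  mem_essImage X := by
    have hξ := X.property
    obtain ⟨Y, π, i, hi, hact⟩ := hΦ.exists_descent hobj hξ
    obtain ⟨a, h₁, h₂, h₃, ha⟩ := hΦ.exists_action hξ i hi hact hobj
    let A : Action K := ⟨Y, π, a, h₁, h₂, h₃⟩
    have hA := A.isDiscreteOpfibration_totalProj
    let F₀ : (pb A.totalProj Φ).obj ⟶ X.obj.left.obj := i.hom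
    obtain ⟨F, hF, hF'⟩ := IsDiscreteOpfibration.exists_hom_of_act (hA.pbSnd Φ) hξ F₀ hi (by
      intro T z u hz
      obtain ⟨y, hyz⟩ : ∃ y : T ⟶ Y, y = z ≫ (pbFst A.totalProj Φ).obj := ⟨_, rfl⟩
      have hy : y ≫ π = (u ≫ H.s) ≫ Φ.obj := by
        rw [← hz, hyz]
        exact (Category.assoc _ _ _).trans ((congrArg (z ≫ ·)
          (isPullback_pb_obj A.totalProj Φ).w).trans (Category.assoc _ _ _).symm)
      have hy' : y ≫ π = (u ≫ Φ.arr) ≫ K.s := by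
        rw [hy, Category.assoc, Category.assoc, Φ.arr_s]
      have hyt : (pullback.lift y (u ≫ Φ.arr) hy' ≫ a) ≫ π = (u ≫ H.t) ≫ Φ.obj := by
        simp [h₁, Φ.arr_t]
      have hzy : z = pullback.lift y (u ≫ H.s) hy :=
        (eq_pbElt z).trans ((pbElt_congr hyz.symm hz _).trans (pbElt_eq_lift _ _ _))
      have hact' : (hA.pbSnd Φ).act z u hz =
          pullback.lift (pullback.lift y (u ≫ Φ.arr) hy' ≫ a) (u ≫ H.t) hyt := by
        refine Eq.trans ?_ (pbElt_eq_lift (p := A.totalProj) (Φ := Φ) _ _ hyt)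
        refine (isPullback_pb_obj _ _).hom_ext ?_ ?_
        · exact (hA.act_pbSnd_fst _ _ _ _).trans ((hA.act_congr hyz.symm rfl _).trans
            ((A.totalProj_act _ _ hy').trans (pbElt_fst (p := A.totalProj) (Φ := Φ) _ _ hyt).symm))
        · exact (IsDiscreteOpfibration.act_obj _ _ _ _).trans (pbElt_snd (p := A.totalProj) (Φ := Φ) _ _ hyt).symm
      -- The ends of `u` are lifts of the ends of its image in `K`. With these lifts the action on
      -- `Y` is transport along that image, which is the action of `u` on `X`.
      refine (congrArg (· ≫ i.hom) hact').trans ((hΦ.lift_transport hξ i hi _ _ (u ≫ H.s) _ hy'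
        (by simp [Φ.arr_s]) (by simp [Φ.arr_t]) _ (ha _ _ _ _ _ _ _) _).trans
          ((hΦ.transport_comp_arr hξ i hi hy).trans ?_))
      exact hξ.act_congr (congrArg (· ≫ i.hom) hzy.symm) rfl _)
    let G : (DOFib.pullback Φ).obj (DOFib.of hA) ⟶ X := DOFib.homMk F hF
    have : IsIso G.hom.left.obj := by
      change IsIso F.obj
      rw [hF']
      exact inferInstanceAs (IsIso i.hom)
    have := DOFib.isIso_of_isIso_obj G
    exact ⟨_, ⟨asIso G⟩⟩

end IsFullyFaithful

end InternalCategory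

theorem mainTheorem5 {C : Type u} [Category.{v} C] [HasFiniteLimits C]
    {H K : InternalCategory C} (Φ : H ⟶ K)
    (hff : InternalCategory.IsFullyFaithful Φ)
    (hobj : InternalCategory.IsEffectiveDescent Φ.obj) :
    (InternalCategory.DOFib.pullback Φ).IsEquivalence where
  faithful := InternalCategory.DOFib.faithful_pullback hobj
  full := hff.full_pullback hobj
  essSurj := hff.essSurj_pullback hobj
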